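/- Let $G=(V,E)$ be a finite simple non-empty graph with vertex weights $w:V\to\mathbb N$ (where $0\in\mathbb N$), given with an interval representation by closed real intervals $I_v=[l_v,r_v]$ whose endpoints are pairwise distinct ($uv\in E$ iff $u\ne v$ and $I_u\cap I_v\neq\emptyset$). Let $\sigma=(v_1,\dots,v_n)$ be the right-endpoint ordering ($u<_\sigma v$ iff $r_u<r_v$). Suppose that $V=A\cup B$ is a special vertex partition with parameter $\kappa$: the sets $A,B$ are disjoint, $A$ is independent, $I_u\not\subseteq I_v$ for all $v\in A$ and $u\in V\setminus\{v\}$, and $|B|\le\kappa$. The weight of a path (all paths are simple and have at least one vertex) is the sum of the weights of its vertices. Add to $G$ and to $B$ an isolated dummy vertex $v_0$ of weight $0$, whose interval lies to the left of all others, and let $V$, $B$, $N(\cdot)$ below refer to the augmented graph. For $v\in B$ let $\xi_v=l_u$ if $l_v\in I_u$ for some (necessarily unique) $u\in A$, and $\xi_v=l_v$ otherwise; let $\Xi=\{\xi_v,l_v:v\in B\}$. For adjacent $u<_\sigma v$ let $\pi_{u,v}$ be the rightmost vertex in $\sigma$ of $\{u\}\cup\{z\in B\cap N(u):u<_\sigma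 z<_\sigma v\}$. For $\xi\in\Xi$ and $\xi<r_{v_i}$ let $G_\xi(v_i)$ be the subgraph induced by $\{v:\xi\le l_v<r_v\le r_{v_i}\}$. A path $(u_1,\dots,u_k)$ is normal if $u_1$ is its leftmost vertex in $\sigma$ and, for each $j\ge2$, $u_j$ is the leftmost vertex in $\sigma$ of $N(u_{j-1})\cap\{u_j,\dots,u_k\}$. Consider the following algorithm, in which a maximum over the empty set is $-\infty$. For $i=0,1,\dots,n$, and for every $\xi\in\Xi$ with $\xi<r_{v_i}$, do: 1. If $v_i\in V(G_\xi(v_i))$, set $W_\xi(v_i,v_i)\leftarrow w(v_i)$. For every $y\in V(G_\xi(v_i))\cap N(v_i)$ set $W_\xi(v_i,y)\leftarrow W_\xi(\pi_{y,v_i},y)$. 2. If $v_i\in V(G_\xi(v_i))$, set $W_1\leftarrow\max\{W_\xi(\pi_{x,v_i},x):x\in V(G_\xi(v_i)),\ l_{v_i}<r_x<r_{v_i}\}$ and $W_\xi(v_i,v_i)\leftarrow\max\{W_\xi(v_i,v_i),\,W_1+w(v_i)\}$. 3. For every $y\in V(G_\xi(v_i))\cap N(v_i)$: if $l_y<l_{v_i}$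 or $v_i\notin V(G_\xi(v_i))$, set $W_\xi(v_i,y)\leftarrow W_\xi(\pi_{y,v_i},y)$. Otherwise set $W_1'\leftarrow\max\{W_\xi(\pi_{x,v_i},x):x\in V(G_\xi(v_i)),\ l_{v_i}<r_x<l_y\}$ and $W_\xi(v_i,y)\leftarrow\max\{W_\xi(v_i,y),\,W_1'+w(v_i)+w(y)\}$; then, for every $\zeta\in\Xi$ with $l_{v_i}<\zeta\le l_y$, set $W_1\leftarrow\max\{W_\xi(\pi_{x,v_i},x):x\in V(G_\xi(v_i)),\ l_{v_i}<r_x<\zeta\}$ and $W_\xi(v_i,y)\leftarrow\max\{W_\xi(v_i,y),\,W_1+w(v_i)+W_\zeta(\pi_{y,v_i},y)\}$. Finally return $\max\{W_{l_{v_0}}(v_i,v_i),\,W_{l_{v_0}}(v_i,y):1\le i\le n,\ y<_\sigma v_i,\ y\in N(v_i)\}$. **Theorem.** Whatever the orders in which the loops over $\xi$, $y$ and $\zeta$ run through their sets, the returned value is the maximum weight of a path in the original graph $G$. Moreover, at the end, for all $i\in\{0,\dots,n\}$, all $\xi\in\Xi$ with $\xi<r_{v_i}$ and all $y\in V(G_\xi(v_i))$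 with $y=v_i$ or $y\in N(v_i)$, the entry $W_\xi(v_i,y)$ is the maximum weight of a normal path of $G_\xi(v_i)$ whose last vertex is $y$. -/

import Mathlib

noncomputable section

open Classical in
/-- `L` lists the elements of the finite set `s`, each exactly once. -/
def Enumerates {α : Type*} (L : List α) (s : Finset α) : Prop :=
  L.Nodup ∧ ∀ x, x ∈ L ↔ x ∈ s

/-- An interval representation of the graph `G` by closed real intervals `[left v, right v]`
whose endpoints are pairwise distinct. -/
structure IntervalRep {V : Type*} (G : SimpleGraph V) where
  left : V → ℝ
  right : V → ℝ
  left_lt_right : ∀ v, left v < right v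
  left_injective : Function.Injective left
  right_injective : Function.Injective right
  left_ne_right : ∀ u v, left u ≠ right v
  adj_iff : ∀ u v, G.Adj u v ↔
    u ≠ v ∧ (Set.Icc (left u) (right u) ∩ Set.Icc (left v) (right v)).Nonempty

namespace IntervalRep

variable {V : Type*} {G : SimpleGraph V}

/-- The closed interval of the vertex `v`. -/
def interval (I : IntervalRep G) (v : V) : Set ℝ := Set.Icc (I.left v) (I.right v)

/-- `(A, B)` is a special vertex partition of `G` with parameter `κ`, and `I` is a special
interval representation with respect to it. -/
structure IsSpecial (I : IntervalRep G) (κ : ℕ) (A B : Finset V) : Prop where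
  disjoint : Disjoint A B
  cover : ∀ v, v ∈ A ∨ v ∈ B
  indep : ∀ u ∈ A, ∀ v ∈ A, ¬ G.Adj u v
  not_subset : ∀ v ∈ A, ∀ u, u ≠ v → ¬ I.interval u ⊆ I.interval v
  card_le : B.card ≤ κ

/-- `σ = (v₁, …, vₙ)` is the right-endpoint ordering of the vertices. -/
def IsRightEndpointOrdering (I : IntervalRep G) (σ : List V) : Prop :=
  (∀ v, v ∈ σ) ∧ σ.Pairwise (fun u v => I.right u < I.right v)

/-- A path is normal if its first vertex is the leftmost of all its vertices (with respect to
right endpoints), and each later vertex `x`, with predecessor `u`, is the leftmost among the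
neighbours of `u` in the part of the path that starts at `x`. -/
def IsNormal (I : IntervalRep G) {a b : V} (p : G.Walk a b) : Prop :=
  p.IsPath ∧ (∀ z ∈ p.support, I.right a ≤ I.right z) ∧
    ∀ (s : List V) (u x : V) (t : List V), p.support = s ++ u :: x :: t →
      ∀ z ∈ x :: t, G.Adj u z → I.right x ≤ I.right z

end IntervalRep

/-- The weight of a path: the sum of the weights of its vertices. -/
def pathWeight {V : Type*} {G : SimpleGraph V} (w : V → ℕ) {a b : V} (p : G.Walk a b) : ℕ :=
  (p.support.map w).sum

/-- The graph `G` together with one isolated extra vertex `none`. -/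
def dummyGraph {V : Type*} (G : SimpleGraph V) : SimpleGraph (Option V) :=
  G.map some

theorem dummyGraph_adj_some {V : Type*} (G : SimpleGraph V) (u v : V) :
    (dummyGraph G).Adj (some u) (some v) ↔ G.Adj u v := by
  unfold dummyGraph
  rw [SimpleGraph.map_adj']
  constructor
  · rintro ⟨-, u', v', h, h1, h2⟩
    cases h1
    cases h2
    exact h
  · intro h
    exact ⟨fun e => h.ne (Option.some_injective _ e), u, v, h, rfl, rfl⟩

theorem dummyGraph_not_adj_none {V : Type*} (G : SimpleGraph V) (u : Option V) :
    ¬ (dummyGraph G).Adj none u := by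
  unfold dummyGraph
  rw [SimpleGraph.map_adj']
  rintro ⟨-, u', v', -, h1, -⟩
  cases h1

/-- The representation `I` together with an interval `[a, b]`, to the left of all other intervals,
for the extra vertex `none`. -/
def IntervalRep.addDummy {V : Type*} {G : SimpleGraph V} (I : IntervalRep G) (a b : ℝ)
    (hab : a < b) (hb : ∀ v, b < I.left v) : IntervalRep (dummyGraph G) where
  left u := u.elim a I.left
  right u := u.elim b I.right
  left_lt_right u := by
    cases u with
    | none => exact hab
    | some v => exact I.left_lt_right v
  left_injective u v h := by
    cases u with
    | none =>
      cases v with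
      | none => rfl
      | some v =>
        have := hb v
        simp only [Option.elim] at h
        linarith
    | some u =>
      cases v with
      | none =>
        have := hb u
        simp only [Option.elim] at h
        linarith
      | some v => exact congrArg some (I.left_injective h)
  right_injective u v h := by
    cases u with
    | none =>
      cases v with
      | none => rfl
      | some v =>
        have := hb v
        have := I.left_lt_right v
        simp only [Option.elim] at h
        linarith
    | some u =>
      cases v with
      | none =>
        have := hb u
        have := I.left_lt_right u
        simp only [Option.elim] at h
        linarith
      | some v => exact congrArg some (I.right_injective h)
  left_ne_right u v h := by
    cases u with
    | none =>
      cases v with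
      | none => exact hab.ne h
      | some v =>
        have := hb v
        have := I.left_lt_right v
        simp only [Option.elim] at h
        linarith
    | some u =>
      cases v with
      | none =>
        have := hb u
        simp only [Option.elim] at h
        linarith
      | some v => exact I.left_ne_right u v h
  adj_iff u v := by
    cases u with
    | none =>
      cases v with
      | none => simp
      | some v =>
        have := hb v
        constructor
        · rintro h
          exact absurd h (dummyGraph_not_adj_none G _)
        · rintro ⟨-, x, ⟨-, h1⟩, ⟨h2, -⟩⟩
          simp only [Option.elim] at h1 h2
          linarith
    | some u =>
      cases v with
      | none =>
        have := hb u
        constructor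
        · rintro h
          exact absurd h.symm (dummyGraph_not_adj_none G _)
        · rintro ⟨-, x, ⟨h2, -⟩, ⟨-, h1⟩⟩
          simp only [Option.elim] at h1 h2
          linarith
      | some v =>
        have h := I.adj_iff u v
        simpa [dummyGraph_adj_some] using h

/-! ### The dynamic program -/

namespace IntervalRep

variable {U : Type*} [Fintype U] {G : SimpleGraph U}

open Classical in
/-- `ξ_v`: the left endpoint of the interval of `A` that contains `left v`, if there is one,
and `left v` otherwise. -/
def xi (I : IntervalRep G) (A : Finset U) (v : U) : ℝ :=
  if h : ∃ u ∈ A, I.left v ∈ I.interval u then I.left h.choose else I.left v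

open Classical in
/-- The set `Ξ = {ξ_v, l_v : v ∈ B}`. -/
def Xi (I : IntervalRep G) (A B : Finset U) : Finset ℝ :=
  B.image (I.xi A) ∪ B.image I.left

/-- The vertex set of `G_ξ(v)`: all vertices whose intervals lie between `ξ` and `right v`. -/
def between (I : IntervalRep G) (ξ : ℝ) (v : U) : Set U :=
  {u | ξ ≤ I.left u ∧ I.left u < I.right u ∧ I.right u ≤ I.right v}

open Classical in
/-- `π_{u,v}`: the vertex with the largest right endpoint in
`{u} ∪ {z ∈ B ∩ N(u) : u < z < v}`. -/
def pi (I : IntervalRep G) (B : Finset U) (u v : U) : U :=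
  (Finset.exists_max_image
    (insert u (B.filter fun z => G.Adj u z ∧ I.right u < I.right z ∧ I.right z < I.right v))
    I.right (Finset.insert_nonempty _ _)).choose

/-- The weights of the normal paths of `G_ξ(v)` (that is, the normal paths of `G` all of whose
vertices lie in the induced subgraph `G_ξ(v)`) whose last vertex is `y`. -/
def normalPathWeights (I : IntervalRep G) (w : U → ℕ) (ξ : ℝ) (v y : U) : Set ℕ :=
  {s | ∃ (a : U) (p : G.Walk a y), I.IsNormal p ∧ (∀ z ∈ p.support, z ∈ I.between ξ v) ∧
    s = pathWeight w p}

end IntervalRep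

/-- A table `W`, with entry `W ξ v y` for `W_ξ(v, y)`. The value `⊥` (minus infinity) stands for
an entry that has not been assigned, and for the maximum of an empty set. -/
abbrev Table (U : Type*) := ℝ → U → U → WithBot ℕ

open Classical in
/-- The assignment `W_ξ(v, y) ← c`. -/
def Table.assign {U : Type*} (W : Table U) (ξ : ℝ) (v y : U) (c : WithBot ℕ) : Table U :=
  fun ξ' v' y' => if ξ' = ξ ∧ v' = v ∧ y' = y then c else W ξ' v' y'

namespace IntervalRep

variable {U : Type*} [Fintype U] {G : SimpleGraph U}

open Classical in
/-- `max {W_ξ(π_{x,v}, x) : x ∈ V(G_ξ(v)), l_v < r_x < q}` (and `⊥` if there is no such `x`). -/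
def maxEntry (I : IntervalRep G) (B : Finset U) (W : Table U) (ξ : ℝ) (v : U) (q : ℝ) :
    WithBot ℕ :=
  (Finset.univ.filter fun x => x ∈ I.between ξ v ∧ I.left v < I.right x ∧ I.right x < q).sup
    fun x => W ξ (I.pi B x v) x

open Classical in
/-- The initialization: `W_ξ(v, v) ← w(v)` if `v ∈ V(G_ξ(v))`, and
`W_ξ(v, y) ← W_ξ(π_{y,v}, y)` for every `y ∈ V(G_ξ(v)) ∩ N(v)`. -/
def initStep (I : IntervalRep G) (w : U → ℕ) (B : Finset U) (ys : List U) (ξ : ℝ) (v : U)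
    (W : Table U) : Table U :=
  (ys.filter fun y => decide (y ∈ I.between ξ v ∧ G.Adj v y)).foldl
    (fun W y => W.assign ξ v y (W ξ (I.pi B y v) y))
    (if v ∈ I.between ξ v then W.assign ξ v v (w v : WithBot ℕ) else W)

open Classical in
/-- The update of `W_ξ(v, v)`: if `v ∈ V(G_ξ(v))`, then
`W₁ ← max {W_ξ(π_{x,v}, x) : x ∈ V(G_ξ(v)), l_v < r_x < r_v}` and
`W_ξ(v, v) ← max {W_ξ(v, v), W₁ + w(v)}`. -/
def diagStep (I : IntervalRep G) (w : U → ℕ) (B : Finset U) (ξ : ℝ) (v : U)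
    (W : Table U) : Table U :=
  if v ∈ I.between ξ v then
    W.assign ξ v v (max (W ξ v v) (I.maxEntry B W ξ v (I.right v) + (w v : WithBot ℕ)))
  else W

open Classical in
/-- The loop over all `ζ ∈ Ξ` with `l_v < ζ ≤ l_y`, with body
`W₁ ← max {W_ξ(π_{x,v}, x) : x ∈ V(G_ξ(v)), l_v < r_x < ζ}`,
`W_ξ(v, y) ← max {W_ξ(v, y), W₁ + w(v) + W_ζ(π_{y,v}, y)}`. -/
def zetaLoop (I : IntervalRep G) (w : U → ℕ) (B : Finset U) (zs : List ℝ) (ξ : ℝ) (v y : U)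
    (W : Table U) : Table U :=
  (zs.filter fun ζ => decide (I.left v < ζ ∧ ζ ≤ I.left y)).foldl
    (fun W ζ => W.assign ξ v y (max (W ξ v y)
      (I.maxEntry B W ξ v ζ + (w v : WithBot ℕ) + W ζ (I.pi B y v) y))) W

open Classical in
/-- The update of `W_ξ(v, y)`. If `l_y < l_v` or `v ∉ V(G_ξ(v))`, then
`W_ξ(v, y) ← W_ξ(π_{y,v}, y)`. Otherwise
`W₁' ← max {W_ξ(π_{x,v}, x) : x ∈ V(G_ξ(v)), l_v < r_x < l_y}`,
`W_ξ(v, y) ← max {W_ξ(v, y), W₁' + w(v) + w(y)}`, followed by the loop over `ζ`. -/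
def offDiagStep (I : IntervalRep G) (w : U → ℕ) (B : Finset U) (zs : List ℝ) (ξ : ℝ) (v y : U)
    (W : Table U) : Table U :=
  if I.left y < I.left v ∨ v ∉ I.between ξ v then
    W.assign ξ v y (W ξ (I.pi B y v) y)
  else
    I.zetaLoop w B zs ξ v y
      (W.assign ξ v y (max (W ξ v y)
        (I.maxEntry B W ξ v (I.left y) + (w v : WithBot ℕ) + (w y : WithBot ℕ))))

open Classical in
/-- The body of the two outer loops, for a vertex `v` and a point `ξ < r_v`. -/
def iteration (I : IntervalRep G) (w : U → ℕ) (B : Finset U) (zs : List ℝ) (ys : List U)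
    (v : U) (ξ : ℝ) (W : Table U) : Table U :=
  (ys.filter fun y => decide (y ∈ I.between ξ v ∧ G.Adj v y)).foldl
    (fun W y => I.offDiagStep w B zs ξ v y W)
    (I.diagStep w B ξ v (I.initStep w B ys ξ v W))

open Classical in
/-- The table after the two outer loops: the vertices `v` run through `vs` in the given order and,
for each of them, `ξ` runs through the points of `xs` with `ξ < r_v`. The lists `zs` and `ys` give
the orders in which the inner loops run through the points `ζ` and the vertices `y`. All entries
are unassigned at the start. -/
def runTable (I : IntervalRep G) (w : U → ℕ) (B : Finset U) (vs : List U) (xs zs : List ℝ)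
    (ys : List U) : Table U :=
  vs.foldl
    (fun W v => (xs.filter fun ξ => decide (ξ < I.right v)).foldl
      (fun W ξ => I.iteration w B zs ys v ξ W) W)
    (fun _ _ _ => ⊥)

end IntervalRep

open Classical in
/-- The value returned by the algorithm from the final table `W`:
`max {W_ξ(v, v), W_ξ(v, y) : v ≠ dummy, y < v, y ∈ N(v)}` with `ξ` the left endpoint of the
dummy vertex `none`. -/
def tableOutput {V : Type*} [Fintype V] {G : SimpleGraph (Option V)} (I : IntervalRep G)
    (W : Table (Option V)) : WithBot ℕ :=
  Finset.univ.sup fun v : V =>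
    max (W (I.left none) (some v) (some v))
      ((Finset.univ.filter fun y => I.right y < I.right (some v) ∧ G.Adj (some v) y).sup
        fun y => W (I.left none) (some v) y)

/-- Extension of the weight function to the dummy vertex, which gets weight `0`. -/
def dummyWeight {V : Type*} (w : V → ℕ) : Option V → ℕ := fun u => u.elim 0 w

/-- The set `A`, seen in the graph with the dummy vertex. -/
def dummyA {V : Type*} (A : Finset V) : Finset (Option V) := A.map Function.Embedding.some

/-- The set `B`, with the dummy vertex added to it. -/
def dummyB {V : Type*} (B : Finset V) : Finset (Option V) := Finset.insertNone B

end

namespace IntervalRep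

variable {V : Type*} {G : SimpleGraph V}

/-! The argument combines three facts about interval graphs with a loop invariant.

Normal paths suffice: the vertices of any path can be reordered into a normal path, of the same
weight (`exists_normalList_perm`).

Normal paths decompose. On a normal path with last vertex `y`, every vertex to the right of `y` in
the ordering has an interval strictly containing that of `y`. If the rightmost vertex `v` is not the
last one, then its predecessor `x` lies entirely to the left of everything after `v`, and the parts
before and after `v` are again normal (`NormalList.split_rightmost`). Conversely, two normal paths
separated by a point `ζ > l_v` can be joined through `v` (`NormalList.append_cons`). This gives the
recursion for the maximum weights.

The special partition keeps the recursion inside the table. A separator can be taken in `Ξ`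
(`IsSpecial.left_mem_Xi`). Intervals of `A` contain no other interval, so all vertices to the right
of the last vertex `x` belong to `B`; hence the paths ending at `x` that stay strictly before `r_v`
are exactly those of the graph bounded by `π_{x,v}` (`IsSpecial.endWeights_eq`).

Apart from the entry being updated, every entry that matters in an update for `v` belongs to a
vertex strictly before `v`. Induction along the ordering therefore proves the table correct for any
order of the inner loops (`IsSpecial.correct_runTable`). -/

theorem adj_iff_le (I : IntervalRep G) {u v : V} :
    G.Adj u v ↔ u ≠ v ∧ I.left u ≤ I.right v ∧ I.left v ≤ I.right u := by
  rw [I.adj_iff]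
  refine and_congr_right fun _ => ⟨?_, ?_⟩
  · rintro ⟨x, ⟨h1, h2⟩, ⟨h3, h4⟩⟩
    exact ⟨h1.trans h4, h3.trans h2⟩
  · rintro ⟨h1, h2⟩
    exact ⟨max (I.left u) (I.left v), ⟨le_max_left _ _, max_le (I.left_lt_right u).le h2⟩,
      ⟨le_max_right _ _, max_le h1 (I.left_lt_right v).le⟩⟩

theorem left_le_of_adj (I : IntervalRep G) {u v : V} (h : G.Adj u v) : I.left u ≤ I.right v :=
  (I.adj_iff_le.1 h).2.1

theorem adj_of_le (I : IntervalRep G) {u v : V} (h : u ≠ v) (h1 : I.left u ≤ I.right v)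
    (h2 : I.left v ≤ I.right u) : G.Adj u v :=
  I.adj_iff_le.2 ⟨h, h1, h2⟩

/-! ### Every path can be rearranged to a normal path -/

/-- In each step, the list goes to the leftmost neighbour among its remaining vertices. -/
def Greedy (I : IntervalRep G) : List V → Prop
  | [] => True
  | [_] => True
  | u :: x :: t => G.Adj u x ∧ (∀ z ∈ x :: t, G.Adj u z → I.right x ≤ I.right z) ∧
      Greedy I (x :: t)

/-- The vertex list of a normal path. -/
structure NormalList (I : IntervalRep G) (L : List V) : Prop where
  nodup : L.Nodup
  head_le : ∀ a ∈ L.head?, ∀ z ∈ L, I.right a ≤ I.right z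
  greedy : I.Greedy L

theorem exists_leftmost (I : IntervalRep G) {L : List V} (hL : L ≠ []) :
    ∃ z ∈ L, ∀ y ∈ L, I.right z ≤ I.right y := by
  classical
  obtain ⟨z, hz, h⟩ := L.toFinset.exists_min_image I.right
    (by simpa [List.toFinset_nonempty_iff] using hL)
  exact ⟨z, by simpa using hz, fun y hy => h y (by simpa using hy)⟩

theorem isChain_adj_reverse {L : List V} (h : L.IsChain G.Adj) : L.reverse.IsChain G.Adj :=
  List.isChain_reverse.2 (h.imp fun _ _ h => h.symm)

/-- Both neighbours of `u` contain the point `r_u`, so they are adjacent and `u` can be cut out. If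
the leftmost remaining vertex `z` is adjacent to `u`, induction applies to the rest. Otherwise `k₁`
is cut out as well and the new path is `u, k₁, z, …`. -/
theorem exists_path_from_interior_leftmost (I : IntervalRep G) {X Y : List V} {k₁ u k₂ : V}
    (hc : (X ++ k₁ :: u :: k₂ :: Y).IsChain G.Adj) (hn : (X ++ k₁ :: u :: k₂ :: Y).Nodup)
    (hu : ∀ z ∈ X ++ k₁ :: u :: k₂ :: Y, I.right u ≤ I.right z) (hk : I.right k₁ ≤ I.right k₂)
    (ih : ∀ L : List V, L.length < (X ++ k₁ :: u :: k₂ :: Y).length → L.IsChain G.Adj → L.Nodup →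
      ∀ z ∈ L, (∀ y ∈ L, I.right z ≤ I.right y) → ∃ M, (z :: M).Perm L ∧ (z :: M).IsChain G.Adj) :
    ∃ M, (u :: M).Perm (X ++ k₁ :: u :: k₂ :: Y) ∧ (u :: M).IsChain G.Adj := by
  obtain ⟨hX, h1u, hY⟩ := List.isChain_append_cons_cons.1 hc
  obtain ⟨hu2, hY⟩ := List.isChain_cons_cons.1 hY
  have hnd := hn
  rw [List.nodup_append'] at hnd
  obtain ⟨hnX, hnr, hdisj⟩ := hnd
  simp only [List.nodup_cons, List.mem_cons, not_or] at hnr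
  have r1 := hu k₁ (by simp)
  have r2 := hu k₂ (by simp)
  have l1 := I.left_le_of_adj h1u
  have l2 := I.left_le_of_adj hu2.symm
  have hk12 : G.Adj k₁ k₂ := I.adj_of_le hnr.1.2.1 (l1.trans r2) (l2.trans r1)
  have hperm1 : (u :: (X ++ k₁ :: k₂ :: Y)).Perm (X ++ k₁ :: u :: k₂ :: Y) :=
    List.perm_middle.symm.trans ((List.Perm.swap k₁ u (k₂ :: Y)).append_left X)
  have hn1 : (u :: (X ++ k₁ :: k₂ :: Y)).Nodup := hperm1.symm.nodup hn
  have hc1 : (X ++ k₁ :: k₂ :: Y).IsChain G.Adj :=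
    List.isChain_append_cons_cons.2 ⟨hX, hk12, hY⟩
  obtain ⟨z, hz, hzmin⟩ := I.exists_leftmost (L := X ++ k₁ :: k₂ :: Y) (by simp)
  by_cases hzu : G.Adj u z
  · obtain ⟨M, hM, hMc⟩ := ih _ (by simp) hc1 (List.nodup_cons.1 hn1).2 z hz hzmin
    exact ⟨z :: M, (hM.cons u).trans hperm1, List.isChain_cons_cons.2 ⟨hzu, hMc⟩⟩
  · have hzk : z ≠ k₁ := fun e => hzu (e ▸ h1u.symm)
    have hz' : z ∈ X ++ k₂ :: Y := by
      simp only [List.mem_append, List.mem_cons] at hz ⊢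
      tauto
    have hperm2 : (k₁ :: (X ++ k₂ :: Y)).Perm (X ++ k₁ :: k₂ :: Y) := List.perm_middle.symm
    have hn2 : (X ++ k₂ :: Y).Nodup :=
      (List.nodup_cons.1 (hperm2.symm.nodup (List.nodup_cons.1 hn1).2)).2
    -- Here `r_{k₁} ≤ r_{k₂}` is used: a predecessor of `k₁` begins before `r_{k₁}`, hence before
    -- `r_{k₂}`, and ends after `r_u ≥ l_{k₂}`.
    have hc2 : (X ++ k₂ :: Y).IsChain G.Adj := by
      obtain ⟨hX1, -, hX2⟩ := List.isChain_append.1 hX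
      refine List.isChain_append.2 ⟨hX1, hY, fun a ha y hy => ?_⟩
      obtain rfl : k₂ = y := by simpa using hy
      have ha1 := I.left_le_of_adj (hX2 a ha k₁ (by simp))
      have haX : a ∈ X := List.mem_of_getLast? ha
      refine I.adj_of_le ?_ (ha1.trans hk) (l2.trans (hu a (by simp [haX])))
      rintro rfl
      exact List.disjoint_left.1 hdisj haX (by simp)
    obtain ⟨M, hM, hMc⟩ := ih _ (by simp) hc2 hn2 z hz'
      fun y hy => hzmin y (hperm2.subset (List.mem_cons_of_mem _ hy))
    have huz : I.right u ≤ I.right z :=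
      hu z (hperm1.subset (List.mem_cons_of_mem _ hz))
    have hkz : G.Adj k₁ z :=
      I.adj_of_le hzk.symm (l1.trans huz)
        ((I.left_lt_right z).le.trans (hzmin k₁ (by simp)))
    exact ⟨k₁ :: z :: M, (((hM.cons k₁).trans hperm2).cons u).trans hperm1,
      List.isChain_cons_cons.2 ⟨h1u.symm, List.isChain_cons_cons.2 ⟨hkz, hMc⟩⟩⟩

theorem exists_path_from_leftmost (I : IntervalRep G) (L : List V) (hc : L.IsChain G.Adj)
    (hn : L.Nodup) (u : V) (hu : u ∈ L) (hmin : ∀ z ∈ L, I.right u ≤ I.right z) :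
    ∃ M, (u :: M).Perm L ∧ (u :: M).IsChain G.Adj := by
  induction hlen : L.length using Nat.strong_induction_on generalizing L u with
  | _ n ih =>
  have ih' : ∀ L' : List V, L'.length < L.length → L'.IsChain G.Adj → L'.Nodup →
      ∀ z ∈ L', (∀ y ∈ L', I.right z ≤ I.right y) →
        ∃ M, (z :: M).Perm L' ∧ (z :: M).IsChain G.Adj :=
    fun L' h1 h2 h3 z h4 h5 => ih _ (hlen ▸ h1) L' h2 h3 z h4 h5 rfl
  obtain ⟨X, Y, rfl⟩ := List.append_of_mem hu
  rcases List.eq_nil_or_concat X with rfl | ⟨X, k₁, rfl⟩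
  · exact ⟨Y, List.Perm.refl _, hc⟩
  cases Y with
  | nil =>
    refine ⟨(X ++ [k₁]).reverse, ?_, ?_⟩
    · simpa using List.reverse_perm (X ++ [k₁] ++ [u])
    · simpa using isChain_adj_reverse hc
  | cons k₂ Y =>
    simp only [List.append_assoc, List.singleton_append, List.concat_eq_append] at *
    -- Reversing the path exchanges the two neighbours of `u`, so either order of their right
    -- endpoints is covered.
    rcases le_total (I.right k₁) (I.right k₂) with hk | hk
    · exact I.exists_path_from_interior_leftmost hc hn hmin hk ih'
    · have hrev : (X ++ k₁ :: u :: k₂ :: Y).reverse = Y.reverse ++ k₂ :: u :: k₁ :: X.reverse := by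
        simp
      obtain ⟨M, hM, hMc⟩ := I.exists_path_from_interior_leftmost (X := Y.reverse) (k₁ := k₂)
        (u := u) (k₂ := k₁) (Y := X.reverse) (hrev ▸ isChain_adj_reverse hc)
        (hrev ▸ List.nodup_reverse.2 hn) (fun z hz => hmin z (by
          rw [← hrev] at hz
          exact List.mem_reverse.1 hz)) hk (fun L' h => ih' L' (by
          rw [← hrev, List.length_reverse] at h
          exact h))
      exact ⟨M, hM.trans (hrev ▸ List.reverse_perm _), hMc⟩

/-- A path from `u` such that no later vertex lies to the left of `u` can be rearranged so that its
second vertex is the leftmost neighbour `x` of `u` on it. -/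
theorem exists_path_second_leftmost (I : IntervalRep G) {u x : V} {S : List V}
    (hc : (u :: S).IsChain G.Adj) (hn : (u :: S).Nodup) (hr : ∀ z ∈ S, I.left u < I.right z)
    (hx : x ∈ S) (hmin : ∀ z ∈ S, G.Adj u z → I.right x ≤ I.right z) :
    ∃ M, (x :: M).Perm S ∧ (x :: M).IsChain G.Adj := by
  have hS : S.IsChain G.Adj := hc.tail
  obtain ⟨hnu, hnS⟩ := List.nodup_cons.1 hn
  by_cases hleft : ∀ z ∈ S, I.right x ≤ I.right z
  · exact I.exists_path_from_leftmost S hS hnS x hx hleft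
  -- A vertex `z` to the left of `x` is not adjacent to `u`, so it lies beyond `r_u`. Then `r_u <
  -- r_x`, and all of `S` ends after `r_u`.
  push Not at hleft
  obtain ⟨z, hz, hzx⟩ := hleft
  have hfar : ∀ y ∈ S, ¬ G.Adj u y → I.right u < I.left y := by
    intro y hy hny
    by_contra hcon
    exact hny (I.adj_of_le (fun e => hnu (e ▸ hy)) (hr y hy).le (not_lt.1 hcon))
  have hzu : I.right u < I.left z := hfar z hz fun h => (hmin z hz h).not_gt hzx
  have hux' : I.right u < I.right x := (hzu.trans (I.left_lt_right z)).trans hzx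
  have hall : ∀ y ∈ S, I.right u < I.right y := by
    intro y hy
    by_cases h : G.Adj u y
    · exact hux'.trans_le (hmin y hy h)
    · exact (hfar y hy h).trans (I.left_lt_right y)
  obtain ⟨X, Y, rfl⟩ := List.append_of_mem hx
  cases X with
  | nil => exact ⟨Y, List.Perm.refl _, hS⟩
  | cons s X =>
    have hus : G.Adj u s := (List.isChain_cons_cons.1 hc).1
    have hs : s ∈ s :: X ++ x :: Y := by simp
    -- The interval of `s` covers everything from `r_u` to `r_x`.
    have hclique : ∀ y ∈ s :: X ++ x :: Y, y ≠ s → I.left y ≤ I.right x → G.Adj s y := by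
      intro y hy hys hyx
      exact I.adj_of_le hys.symm ((I.left_le_of_adj hus.symm).trans (hall y hy).le)
        (hyx.trans (hmin s hs hus))
    have hnd := hnS
    rw [List.nodup_append'] at hnd
    obtain ⟨hnX, hnY, hdisj⟩ := hnd
    have hsY : ∀ y ∈ x :: Y, y ≠ s := by
      rintro y hy rfl
      exact List.disjoint_left.1 hdisj (by simp) hy
    obtain ⟨hcX, hcY, -⟩ := List.isChain_append.1 hS
    obtain ⟨hcX', -⟩ := List.isChain_split.1 hS
    have hrev : (x :: (s :: X).reverse).IsChain G.Adj := by
      simpa using isChain_adj_reverse hcX'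
    -- The segment from `s` to `x` is reversed. The new junction from `s` to the first vertex of `Y`
    -- is an edge because that vertex is adjacent to `x` and so begins before `r_x`.
    refine ⟨(s :: X).reverse ++ Y, ?_, ?_⟩
    · exact (((List.reverse_perm (s :: X)).append_right Y).cons x).trans List.perm_middle.symm
    · rw [← List.cons_append]
      refine List.isChain_append.2 ⟨hrev, hcY.tail, fun a ha y hy => ?_⟩
      obtain rfl : s = a := by
        rw [List.reverse_cons, ← List.cons_append, List.getLast?_concat] at ha
        simpa using ha
      have hyY : y ∈ Y := List.mem_of_mem_head? hy
      refine hclique y (by simp [hyY]) (hsY y (by simp [hyY])) ?_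
      exact I.left_le_of_adj ((List.isChain_cons.1 hcY).1 y hy).symm

/-- The current vertex need not remain leftmost along the induction. What persists, and suffices, is
that no later vertex lies entirely to its left: neighbours of `u` end no earlier than `x`, and
non-neighbours lie beyond `r_u ≥ l_x`. -/
theorem exists_greedy_perm (I : IntervalRep G) (S : List V) (u : V)
    (hc : (u :: S).IsChain G.Adj) (hn : (u :: S).Nodup) (hr : ∀ z ∈ S, I.left u < I.right z) :
    ∃ M, M.Perm S ∧ I.Greedy (u :: M) := by
  classical
  induction hlen : S.length generalizing S u with
  | zero =>
    obtain rfl : S = [] := List.length_eq_zero_iff.1 hlen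
    exact ⟨[], List.Perm.refl _, trivial⟩
  | succ n ih =>
    have hex : ∃ z ∈ S, G.Adj u z := by
      cases S with
      | nil => simp at hlen
      | cons s S => exact ⟨s, by simp, (List.isChain_cons_cons.1 hc).1⟩
    obtain ⟨x, hx, hmin⟩ := I.exists_leftmost (L := S.filter fun z => decide (G.Adj u z)) (by
      obtain ⟨z, hz, h⟩ := hex
      exact List.ne_nil_of_mem (List.mem_filter.2 ⟨hz, by simpa using h⟩))
    simp only [List.mem_filter, decide_eq_true_eq] at hx hmin
    have hmin' : ∀ z ∈ S, G.Adj u z → I.right x ≤ I.right z := fun z hz h => hmin z ⟨hz, h⟩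
    obtain ⟨M, hM, hMc⟩ := I.exists_path_second_leftmost hc hn hr hx.1 hmin'
    have hMn : (x :: M).Nodup := hM.symm.nodup (List.nodup_cons.1 hn).2
    obtain ⟨M', hM', hg⟩ := ih M x hMc hMn (fun z hz => by
      have hzS : z ∈ S := hM.subset (List.mem_cons_of_mem _ hz)
      by_cases h : G.Adj u z
      · exact (I.left_lt_right x).trans_le (hmin' z hzS h)
      · have : I.right u < I.left z := by
          by_contra hcon
          exact h (I.adj_of_le (fun e => (List.nodup_cons.1 hn).1 (e ▸ hzS)) (hr z hzS).le
            (not_lt.1 hcon))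
        exact (I.left_le_of_adj hx.2.symm).trans_lt (this.trans (I.left_lt_right z))) (by
      have := hM.length_eq
      simp only [List.length_cons] at this
      omega)
    have hp : (x :: M').Perm S := (hM'.cons x).trans hM
    exact ⟨x :: M', hp, hx.2, fun z hz h => hmin' z (hp.subset hz) h, hg⟩

/-- The vertices of a path can be rearranged to a normal path. -/
theorem exists_normalList_perm (I : IntervalRep G) {L : List V} (hc : L.IsChain G.Adj)
    (hn : L.Nodup) : ∃ M, M.Perm L ∧ I.NormalList M := by
  rcases eq_or_ne L [] with rfl | hL
  · exact ⟨[], List.Perm.refl _, List.nodup_nil, by simp, trivial⟩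
  obtain ⟨u, hu, hmin⟩ := I.exists_leftmost hL
  obtain ⟨S, hS, hSc⟩ := I.exists_path_from_leftmost L hc hn u hu hmin
  obtain ⟨M, hM, hg⟩ := I.exists_greedy_perm S u hSc (hS.symm.nodup hn) fun z hz =>
    (I.left_lt_right u).trans_le (hmin z (hS.subset (List.mem_cons_of_mem _ hz)))
  have hp : (u :: M).Perm L := (hM.cons u).trans hS
  refine ⟨u :: M, hp, hp.symm.nodup hn, fun a ha z hz => ?_, hg⟩
  obtain rfl : u = a := by simpa using ha
  exact hmin z (hp.subset hz)

/-! ### The structure of normal paths -/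

theorem Greedy.of_append_right {I : IntervalRep G} {s t : List V} (h : I.Greedy (s ++ t)) :
    I.Greedy t := by
  induction s with
  | nil => exact h
  | cons a s ih =>
    refine ih ?_
    rw [List.cons_append] at h
    generalize s ++ t = L at h
    cases L with
    | nil => trivial
    | cons b L => exact h.2.2

theorem Greedy.of_append_left {I : IntervalRep G} {s t : List V} (h : I.Greedy (s ++ t)) :
    I.Greedy s := by
  induction s with
  | nil => trivial
  | cons a s ih =>
    cases s with
    | nil => trivial
    | cons b s =>
      obtain ⟨h1, h2, h3⟩ := h
      exact ⟨h1, fun z hz => h2 z (List.mem_append_left t hz), ih h3⟩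

theorem Greedy.isChain {I : IntervalRep G} {L : List V} (h : I.Greedy L) :
    L.IsChain G.Adj := by
  induction L with
  | nil => exact List.IsChain.nil
  | cons a L ih =>
    cases L with
    | nil => exact List.IsChain.singleton a
    | cons b L => exact List.isChain_cons_cons.2 ⟨h.1, ih h.2.2⟩

theorem Greedy.right_le {I : IntervalRep G} {s t : List V} {u x z : V}
    (h : I.Greedy (s ++ u :: x :: t)) (hz : z ∈ x :: t) (huz : G.Adj u z) :
    I.right x ≤ I.right z :=
  h.of_append_right.2.1 z hz huz

theorem greedy_iff (I : IntervalRep G) (L : List V) : I.Greedy L ↔ L.IsChain G.Adj ∧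
    ∀ (s : List V) (u x : V) (t : List V), L = s ++ u :: x :: t →
      ∀ z ∈ x :: t, G.Adj u z → I.right x ≤ I.right z := by
  constructor
  · intro h
    refine ⟨h.isChain, ?_⟩
    rintro s u x t rfl z hz huz
    exact h.right_le hz huz
  · rintro ⟨hc, h⟩
    induction L with
    | nil => trivial
    | cons a L ih =>
      cases L with
      | nil => trivial
      | cons b L =>
        obtain ⟨hab, hc⟩ := List.isChain_cons_cons.1 hc
        exact ⟨hab, h [] a b L rfl, ih hc fun s u x t e => h (a :: s) u x t (by rw [e]; rfl)⟩

/-- The hypothesis says that no vertex of `Q` can beat the choice made at a vertex `p` of `P`: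
either it is to the right of all candidates, or `x` is a candidate at least as good. -/
theorem Greedy.append {I : IntervalRep G} {P Q : List V} {x : V} (hP : I.Greedy (P ++ [x]))
    (hQ : I.Greedy (x :: Q))
    (h : ∀ p ∈ P, ∀ q ∈ Q, G.Adj p q →
      (∀ z ∈ P ++ [x], I.right z ≤ I.right q) ∨ (G.Adj p x ∧ I.right x ≤ I.right q)) :
    I.Greedy (P ++ x :: Q) := by
  induction P with
  | nil => exact hQ
  | cons a P ih =>
    have ih' := ih (hP.of_append_right (s := [a])) fun p hp q hq hpq =>
      (h p (List.mem_cons_of_mem _ hp) q hq hpq).imp_left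
        fun h z hz => h z (List.mem_cons_of_mem _ hz)
    have key : ∀ b t, P ++ [x] = b :: t → G.Adj a b ∧
        ∀ z ∈ b :: t ++ Q, G.Adj a z → I.right b ≤ I.right z := by
      intro b t e
      rw [List.cons_append, e] at hP
      refine ⟨hP.1, fun z hz haz => ?_⟩
      rcases List.mem_append.1 hz with hz | hz
      · exact hP.2.1 z hz haz
      · rcases h a (by simp) z hz haz with h1 | ⟨h1, h2⟩
        · exact h1 b (by simp [e])
        · exact (hP.2.1 x (e ▸ by simp) h1).trans h2
    cases P with
    | nil =>
      obtain ⟨h1, h2⟩ := key x [] rfl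
      exact ⟨h1, h2, ih'⟩
    | cons b P =>
      obtain ⟨h1, h2⟩ := key b (P ++ [x]) rfl
      exact ⟨h1, by simpa using h2, ih'⟩

/-- If the path stepped from `u`, with `l_u ≤ r_y`, to a vertex beginning after `r_y`, then `u`
would reach past `y` and be adjacent to it, and the greedy choice would have preferred `y`. -/
theorem Greedy.left_le {I : IntervalRep G} {P : List V} {y : V} (h : I.Greedy (P ++ [y]))
    (hn : (P ++ [y]).Nodup) (hhead : ∀ a ∈ (P ++ [y]).head?, I.left a ≤ I.right y) :
    ∀ z ∈ P ++ [y], I.left z ≤ I.right y := by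
  induction P with
  | nil => simpa using (I.left_lt_right y).le
  | cons u P ih =>
    have hu : I.left u ≤ I.right y := hhead u (by simp)
    have huy : u ≠ y := by
      rintro rfl
      simp at hn
    have hy : y ∈ P ++ [y] := by simp
    have := ih (h.of_append_right (s := [u])) (List.nodup_cons.1 hn).2 (by
      rw [List.cons_append] at h
      generalize P ++ [y] = L at h hy
      intro x hx
      cases L with
      | nil => simp at hx
      | cons b t =>
        obtain rfl : b = x := by simpa using hx
        by_contra hcon
        have hux := I.left_le_of_adj h.1.symm
        have := h.2.1 y hy (I.adj_of_le huy hu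
          ((I.left_lt_right y).le.trans ((not_le.1 hcon).le.trans hux)))
        exact hcon ((I.left_lt_right b).le.trans this))
    simpa [hu] using this

theorem NormalList.left_le {I : IntervalRep G} {P : List V} {y : V}
    (h : I.NormalList (P ++ [y])) : ∀ z ∈ P ++ [y], I.left z ≤ I.right y :=
  h.greedy.left_le h.nodup fun a ha => (I.left_lt_right a).le.trans (h.head_le a ha y (by simp))

/-- The vertex `x` preferred `v` although `y` is further left, so `x` and `y` are not adjacent; as
`x` begins before `r_y`, it lies to the left of `y`. -/
theorem NormalList.right_lt_left {I : IntervalRep G} {P Q : List V} {x v y : V}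
    (h : I.NormalList (P ++ [x] ++ v :: (Q ++ [y]))) (hvy : I.right y < I.right v) :
    I.right x < I.left y := by
  have e : P ++ [x] ++ v :: (Q ++ [y]) = P ++ x :: v :: (Q ++ [y]) := by simp
  have e' : P ++ [x] ++ v :: (Q ++ [y]) = (P ++ x :: v :: Q) ++ [y] := by simp
  have hg := h.greedy
  rw [e] at hg
  have hna : ¬ G.Adj x y := fun ha => hvy.not_ge (hg.right_le (by simp) ha)
  have hl := (e' ▸ h).left_le x (by simp)
  have hxy : x ≠ y := by
    rintro rfl
    have := h.nodup
    rw [List.nodup_append'] at this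
    exact List.disjoint_left.1 this.2.2 (show x ∈ P ++ [x] by simp) (by simp)
  by_contra hcon
  exact hna (I.adj_of_le hxy hl (not_lt.1 hcon))

theorem NormalList.exists_eq_append {I : IntervalRep G} {P : List V} {v y : V}
    (h : I.NormalList (P ++ [y])) (hv : v ∈ P ++ [y]) (hvy : I.right y < I.right v) :
    ∃ (S : List V) (x : V) (Q : List V), P ++ [y] = S ++ [x] ++ v :: (Q ++ [y]) := by
  have hvP : v ∈ P := by
    rcases List.mem_append.1 hv with h | h
    · exact h
    · obtain rfl : v = y := by simpa using h
      exact absurd hvy (lt_irrefl _)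
  obtain ⟨S, Q, rfl⟩ := List.append_of_mem hvP
  rcases List.eq_nil_or_concat S with rfl | ⟨S, x, rfl⟩
  · exact absurd (h.head_le v (by simp) y (by simp)) hvy.not_ge
  · exact ⟨S, x, Q, by simp⟩

theorem NormalList.adj_of_append {I : IntervalRep G} {P Q : List V} {x v : V}
    (h : I.NormalList (P ++ [x] ++ v :: Q)) : G.Adj x v := by
  have hc := h.greedy.isChain
  rw [List.append_assoc] at hc
  exact (List.isChain_append_cons_cons.1 hc).2.1

/-- A vertex of a normal path that is to the right of its last vertex contains the last vertex. -/
theorem NormalList.left_lt_left {I : IntervalRep G} {P : List V} {v y : V}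
    (h : I.NormalList (P ++ [y])) (hv : v ∈ P ++ [y]) (hvy : I.right y < I.right v) :
    I.left v < I.left y := by
  obtain ⟨S, x, Q, e⟩ := h.exists_eq_append hv hvy
  rw [e] at h
  exact (I.left_le_of_adj h.adj_of_append.symm).trans_lt (h.right_lt_left hvy)

theorem NormalList.adj_last {I : IntervalRep G} {P : List V} {v y : V}
    (h : I.NormalList (P ++ [y])) (hv : v ∈ P ++ [y]) (hvy : I.right y < I.right v) :
    G.Adj v y :=
  I.adj_of_le (by rintro rfl; exact lt_irrefl _ hvy)
    ((h.left_lt_left hv hvy).le.trans (I.left_lt_right y).le)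
    ((I.left_lt_right y).le.trans hvy.le)

theorem NormalList.of_append_left {I : IntervalRep G} {P Q : List V}
    (h : I.NormalList (P ++ Q)) : I.NormalList P where
  nodup := (List.nodup_append'.1 h.nodup).1
  head_le a ha z hz := h.head_le a (by
    rw [List.head?_append, Option.mem_def.1 ha]
    rfl) z (List.mem_append_left _ hz)
  greedy := h.greedy.of_append_left

/-- A path all of whose intervals miss that of `x` cannot jump over it, so it stays on the side of
its last vertex. -/
theorem right_lt_left_of_isChain (I : IntervalRep G) {Q : List V} {x y : V}
    (hc : (Q ++ [y]).IsChain G.Adj)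
    (h : ∀ q ∈ Q ++ [y], I.right q < I.left x ∨ I.right x < I.left q)
    (hy : I.right x < I.left y) : ∀ q ∈ Q ++ [y], I.right x < I.left q := by
  induction Q with
  | nil => simpa using hy
  | cons q Q ih =>
    have ih' := ih hc.tail fun z hz => h z (List.mem_cons_of_mem _ hz)
    have hq : I.right x < I.left q := by
      refine (h q (by simp)).resolve_left fun hq => ?_
      rw [List.cons_append] at hc
      have hne : Q ++ [y] ≠ [] := by simp
      generalize Q ++ [y] = L at hc ih' hne
      cases L with
      | nil => exact hne rfl
      | cons b L =>
        have h1 := I.left_le_of_adj (List.isChain_cons_cons.1 hc).1.symm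
        have h2 := ih' b (by simp)
        linarith [I.left_lt_right x]
    intro z hz
    rcases List.mem_cons.1 hz with rfl | hz
    · exact hq
    · exact ih' z hz

/-- The two parts of a normal path before and after its rightmost vertex `v`. -/
theorem NormalList.split_rightmost {I : IntervalRep G} {P Q : List V} {x v y : V}
    (h : I.NormalList (P ++ [x] ++ v :: (Q ++ [y])))
    (hr : ∀ z ∈ P ++ [x] ++ v :: (Q ++ [y]), I.right z ≤ I.right v) :
    I.NormalList (Q ++ [y]) ∧ ∀ q ∈ Q ++ [y], I.right x < I.left q := by
  have hnd := List.nodup_append'.1 h.nodup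
  have hnv := List.nodup_cons.1 hnd.2.1
  have hlt : ∀ q ∈ Q ++ [y], I.right q < I.right v := fun q hq =>
    (hr q (List.mem_append_right _ (List.mem_cons_of_mem _ hq))).lt_of_ne fun e =>
      hnv.1 (I.right_injective e ▸ hq)
  have hxy := h.right_lt_left (hlt y (by simp))
  have hg : I.Greedy (P ++ x :: v :: (Q ++ [y])) := by simpa using h.greedy
  have hgv : I.Greedy (v :: (Q ++ [y])) := h.greedy.of_append_right
  have hgQ : I.Greedy (Q ++ [y]) := hgv.of_append_right (s := [v])
  -- A later `q` adjacent to `x` would have been chosen instead of `v`, since `v` is rightmost. So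
  -- every such `q` misses `x`.
  have hright : ∀ q ∈ Q ++ [y], I.right x < I.left q := by
    refine I.right_lt_left_of_isChain hgQ.isChain (fun q hq => ?_) hxy
    by_contra! hcon
    refine (hlt q hq).not_ge (hg.right_le (List.mem_cons_of_mem _ hq) (I.adj_of_le ?_ hcon.1 hcon.2))
    rintro rfl
    exact List.disjoint_left.1 hnd.2.2 (show x ∈ P ++ [x] by simp) (List.mem_cons_of_mem _ hq)
  refine ⟨⟨hnv.2, fun a ha z hz => ?_, hgQ⟩, hright⟩
  -- From `l_v ≤ r_x < l_z` and `r_z < r_v`, the vertex `v` is adjacent to everything after it; the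
  -- greedy choice at `v` thus makes the second part start at its leftmost vertex.
  have hvz : G.Adj v z := by
    have h1 := I.left_le_of_adj h.adj_of_append.symm
    have h2 := hright z hz
    have h3 := hlt z hz
    have h4 := I.left_lt_right z
    refine I.adj_of_le ?_ (by linarith) (by linarith)
    rintro rfl
    exact lt_irrefl _ h3
  generalize Q ++ [y] = L at *
  cases L with
  | nil => simp at ha
  | cons b L =>
    obtain rfl : b = a := by simpa using ha
    exact hgv.2.1 z hz hvz

/-- Composition of two normal paths through a vertex `v` to the right of both. -/
theorem NormalList.append_cons {I : IntervalRep G} {P Q : List V} {x v : V}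
    (hP : I.NormalList (P ++ [x])) (hQ : I.NormalList Q)
    (hPv : ∀ z ∈ P ++ [x], I.right z < I.right v) (hQv : ∀ z ∈ Q, I.right z < I.right v)
    (hvx : I.left v < I.right x) (hxQ : ∀ q ∈ Q, I.right x < I.left q) :
    I.NormalList (P ++ [x] ++ v :: Q) := by
  have hxv := hPv x (by simp)
  have hgv : I.Greedy (v :: Q) := by
    cases Q with
    | nil => trivial
    | cons q Q =>
      refine ⟨?_, fun z hz _ => hQ.head_le q (by simp) z hz, hQ.greedy⟩
      have h1 := hxQ q (by simp)
      have h2 := hQv q (by simp)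
      have h3 := I.left_lt_right q
      refine I.adj_of_le ?_ (by linarith) (by linarith)
      rintro rfl
      exact lt_irrefl _ h2
  have hxv' : G.Adj x v := by
    refine I.adj_of_le ?_ (by linarith [I.left_lt_right x]) hvx.le
    rintro rfl
    exact lt_irrefl _ hxv
  refine ⟨?_, ?_, ?_⟩
  · refine List.nodup_append'.2 ⟨hP.nodup, List.nodup_cons.2
      ⟨fun hv => lt_irrefl _ (hQv v hv), hQ.nodup⟩, ?_⟩
    rw [List.disjoint_left]
    intro z hz hz'
    rcases List.mem_cons.1 hz' with rfl | hz'
    · exact lt_irrefl _ (hPv z hz)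
    · exact ((hP.left_le z hz).trans_lt (hxQ z hz')).false
  · intro a ha z hz
    have ha' : a ∈ (P ++ [x]).head? := by
      cases P <;> simpa using ha
    have haP : a ∈ P ++ [x] := List.mem_of_mem_head? ha'
    rcases List.mem_append.1 hz with hz | hz
    · exact hP.head_le a ha' z hz
    · rcases List.mem_cons.1 hz with rfl | hz
      · exact (hPv a haP).le
      · have h1 := hP.head_le a ha' x (by simp)
        have h2 := hxQ z hz
        have h3 := I.left_lt_right z
        linarith
  · rw [List.append_assoc, List.singleton_append]
    refine hP.greedy.append ⟨hxv', fun z hz hxz => ?_, hgv⟩ fun p hp q hq hpq => ?_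
    · rcases List.mem_cons.1 hz with rfl | hz
      · exact le_rfl
      · exact absurd (I.left_le_of_adj hxz.symm) (hxQ z hz).not_ge
    · rcases List.mem_cons.1 hq with rfl | hq
      · exact Or.inl fun z hz => (hPv z hz).le
      -- The interval of `p` begins before `r_x` by `left_le` and reaches `q` beyond `r_x`, so `p`
      -- is adjacent to `x`.
      · refine Or.inr ⟨?_, ((hxQ q hq).trans (I.left_lt_right q)).le⟩
        have h1 := hxQ q hq
        have h2 := I.left_le_of_adj hpq.symm
        refine I.adj_of_le ?_ (hP.left_le p (by simp [hp])) (by linarith [I.left_lt_right x])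
        rintro rfl
        linarith

theorem exists_adj_of_isChain {L : List V} {q : V} (hc : L.IsChain G.Adj) (hq : q ∈ L)
    (hlen : 2 ≤ L.length) : ∃ q' ∈ L, G.Adj q q' := by
  obtain ⟨S, T, rfl⟩ := List.append_of_mem hq
  cases T with
  | cons t T => exact ⟨t, by simp, (List.isChain_append_cons_cons.1 hc).2.1⟩
  | nil =>
    rcases List.eq_nil_or_concat S with rfl | ⟨S, s, rfl⟩
    · simp at hlen
    · rw [List.concat_eq_append, List.append_assoc] at hc
      exact ⟨s, by simp, (List.isChain_append_cons_cons.1 hc).2.1.symm⟩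

end IntervalRep

namespace IntervalRep

/-! ### The recursion for the weights of normal paths -/

section

variable {V : Type*} {G : SimpleGraph V}

/-- The weights of the normal paths with last vertex `y` all of whose vertices lie between `ξ` and
`c`, the right end `c` excluded. -/
def endWeights (I : IntervalRep G) (w : V → ℕ) (ξ c : ℝ) (y : V) : Set ℕ :=
  {s | ∃ P : List V, I.NormalList (P ++ [y]) ∧ (∀ z ∈ P ++ [y], ξ ≤ I.left z ∧ I.right z < c) ∧
    s = ((P ++ [y]).map w).sum}

theorem mem_between {I : IntervalRep G} {ξ : ℝ} {u v : V} :
    u ∈ I.between ξ v ↔ ξ ≤ I.left u ∧ I.right u ≤ I.right v :=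
  ⟨fun h => ⟨h.1, h.2.2⟩, fun h => ⟨h.1, I.left_lt_right u, h.2⟩⟩

theorem isNormal_iff (I : IntervalRep G) {a y : V} (p : G.Walk a y) :
    I.IsNormal p ↔ I.NormalList p.support := by
  have hhead : p.support.head? = some a := by
    rw [← p.cons_tail_support]
    rfl
  constructor
  · rintro ⟨h1, h2, h3⟩
    refine ⟨h1.support_nodup, ?_, (I.greedy_iff _).2 ⟨p.isChain_adj_support, h3⟩⟩
    intro b hb
    rw [hhead] at hb
    obtain rfl : a = b := by simpa using hb
    exact h2
  · rintro ⟨h1, h2, h3⟩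
    exact ⟨SimpleGraph.Walk.IsPath.mk' h1, h2 a (by simp [hhead]), ((I.greedy_iff _).1 h3).2⟩

theorem exists_walk_support_eq {L : List V} (hc : L.IsChain G.Adj) (hL : L ≠ []) :
    ∃ p : G.Walk (L.head hL) (L.getLast hL), p.support = L :=
  ⟨SimpleGraph.Walk.ofSupport L hL hc, SimpleGraph.Walk.support_ofSupport hL hc⟩

theorem exists_support_eq_append {a y : V} (p : G.Walk a y) : ∃ P, p.support = P ++ [y] :=
  ⟨p.support.dropLast, by
    conv_lhs => rw [← List.dropLast_append_getLast p.support_ne_nil]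
    rw [p.getLast_support]⟩

theorem mem_normalPathWeights (I : IntervalRep G) (w : V → ℕ) (ξ : ℝ) (v y : V) (s : ℕ) :
    s ∈ I.normalPathWeights w ξ v y ↔ ∃ P : List V, I.NormalList (P ++ [y]) ∧
      (∀ z ∈ P ++ [y], z ∈ I.between ξ v) ∧ s = ((P ++ [y]).map w).sum := by
  constructor
  · rintro ⟨a, p, hp, hb, rfl⟩
    obtain ⟨P, hP⟩ := exists_support_eq_append p
    rw [isNormal_iff] at hp
    exact ⟨P, hP ▸ hp, hP ▸ hb, by rw [pathWeight, hP]⟩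
  · rintro ⟨P, hP, hb, rfl⟩
    obtain ⟨p, hp⟩ := exists_walk_support_eq hP.greedy.isChain (by simp)
    -- The walk ends at the last element of the list, which equals `y` only propositionally; a
    -- variable endpoint can be substituted.
    have key : ∀ (y' : V) (p : G.Walk ((P ++ [y]).head (by simp)) y'), y' = y →
        p.support = P ++ [y] → ((P ++ [y]).map w).sum ∈ I.normalPathWeights w ξ v y := by
      rintro y' p rfl hp
      exact ⟨_, p, (I.isNormal_iff p).2 (by rwa [hp]), by rwa [hp], by rw [pathWeight, hp]⟩
    exact key _ p (by simp) hp

theorem singleton_normalList (I : IntervalRep G) (y : V) : I.NormalList [y] :=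
  ⟨by simp, by simp, trivial⟩

theorem normalPathWeights_nonempty (I : IntervalRep G) (w : V → ℕ) {ξ : ℝ} {v y : V}
    (hy : y ∈ I.between ξ v) : (I.normalPathWeights w ξ v y).Nonempty :=
  ⟨_, (I.mem_normalPathWeights w ξ v y _).2
    ⟨[], I.singleton_normalList y, by simpa using hy, rfl⟩⟩

theorem endWeights_subset (I : IntervalRep G) (w : V → ℕ) (ξ : ℝ) (v y : V) :
    I.endWeights w ξ (I.right v) y ⊆ I.normalPathWeights w ξ v y := by
  rintro s ⟨P, hP, hb, rfl⟩
  exact (I.mem_normalPathWeights w ξ v y _).2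
    ⟨P, hP, fun z hz => mem_between.2 ⟨(hb z hz).1, (hb z hz).2.le⟩, rfl⟩

/-- If `v` is not in `G_ξ(v)` or the interval of `y` is not contained in that of `v`, then
no normal path of `G_ξ(v)` with last vertex `y ≠ v` contains `v`. -/
theorem normalPathWeights_eq_endWeights (I : IntervalRep G) (w : V → ℕ) {ξ : ℝ} {v y : V}
    (hy : I.right y < I.right v) (h : I.left y < I.left v ∨ v ∉ I.between ξ v) :
    I.normalPathWeights w ξ v y = I.endWeights w ξ (I.right v) y := by
  refine Set.Subset.antisymm ?_ (I.endWeights_subset w ξ v y)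
  intro s hs
  obtain ⟨P, hP, hb, rfl⟩ := (I.mem_normalPathWeights w ξ v y s).1 hs
  refine ⟨P, hP, fun z hz => ⟨(hb z hz).1, (hb z hz).2.2.lt_of_ne fun e => ?_⟩, rfl⟩
  obtain rfl := I.right_injective e
  rcases h with h | h
  · exact lt_asymm h (hP.left_lt_left hz hy)
  · exact h (hb z hz)

/-- The weights of the normal paths that end at a vertex `x` with `l_v < r_x < q`. -/
def prefixWeights (I : IntervalRep G) (w : V → ℕ) (ξ : ℝ) (v : V) (q : ℝ) : Set ℕ :=
  {s | ∃ x, (x ∈ I.between ξ v ∧ I.left v < I.right x ∧ I.right x < q) ∧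
    s ∈ I.endWeights w ξ (I.right v) x}

theorem sum_map_append_cons (w : V → ℕ) (P Q : List V) (v : V) :
    ((P ++ v :: Q).map w).sum = (P.map w).sum + w v + (Q.map w).sum := by
  simp [add_assoc]

theorem NormalList.sum_mem_prefixWeights {I : IntervalRep G} (w : V → ℕ) {P Q : List V} {x v : V}
    {ξ q : ℝ} (h : I.NormalList (P ++ [x] ++ v :: Q))
    (hb : ∀ z ∈ P ++ [x] ++ v :: Q, z ∈ I.between ξ v) (hq : I.right x < q) :
    ((P ++ [x]).map w).sum ∈ I.prefixWeights w ξ v q := by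
  have hnd := List.nodup_append'.1 h.nodup
  have hlt : ∀ z ∈ P ++ [x], I.right z < I.right v := fun z hz =>
    (hb z (List.mem_append_left _ hz)).2.2.lt_of_ne fun e =>
      List.disjoint_left.1 hnd.2.2 (I.right_injective e ▸ hz) (by simp)
  exact ⟨x, ⟨hb x (by simp), (I.left_le_of_adj h.adj_of_append.symm).lt_of_ne
    (I.left_ne_right v x), hq⟩, P, h.of_append_left,
    fun z hz => ⟨(hb z (List.mem_append_left _ hz)).1, hlt z hz⟩, rfl⟩

/-- No vertex of `G_ξ(v)` is to the right of `v`, so removing the final `v` leaves either nothing or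
a normal path ending at a neighbour of `v`. The converse is `append_cons` with an empty second part.
-/
theorem normalPathWeights_self (I : IntervalRep G) (w : V → ℕ) {ξ : ℝ} {v : V}
    (hv : v ∈ I.between ξ v) (s : ℕ) : s ∈ I.normalPathWeights w ξ v v ↔
      s = w v ∨ ∃ s₁ ∈ I.prefixWeights w ξ v (I.right v), s = s₁ + w v := by
  rw [mem_normalPathWeights]
  constructor
  · rintro ⟨P, hP, hb, rfl⟩
    rcases List.eq_nil_or_concat P with rfl | ⟨P, x, rfl⟩
    · left
      simp
    · rw [List.concat_eq_append] at *
      refine Or.inr ⟨_, hP.sum_mem_prefixWeights w hb ?_, by simp [add_assoc]⟩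
      refine (hb x (by simp)).2.2.lt_of_ne fun e => ?_
      have := (List.nodup_append'.1 hP.nodup).2.2
      exact List.disjoint_left.1 this (show x ∈ P ++ [x] by simp) (by simp [I.right_injective e])
  · rintro (rfl | ⟨s, ⟨x, ⟨-, hx, -⟩, P, hP, hb, rfl⟩, rfl⟩)
    · exact ⟨[], I.singleton_normalList v, by simpa using hv, by simp⟩
    · refine ⟨P ++ [x], hP.append_cons ⟨by simp, by simp, trivial⟩ (fun z hz => (hb z hz).2)
        (by simp) hx (by simp), ?_, by simp [add_assoc]⟩
      intro z hz
      rcases List.mem_append.1 hz with hz | hz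
      · exact mem_between.2 ⟨(hb z hz).1, (hb z hz).2.le⟩
      · obtain rfl : z = v := by simpa using hz
        exact hv

/-- The point `ζ` separates the two parts: the first ends at `x` with `r_x < ζ`, and the second
begins at `ζ` or later. -/
theorem add_add_mem_normalPathWeights (I : IntervalRep G) (w : V → ℕ) {ξ ζ : ℝ} {v y : V}
    (hv : v ∈ I.between ξ v) (hζ : I.left v < ζ) {s₁ s₂ : ℕ}
    (h1 : s₁ ∈ I.prefixWeights w ξ v ζ) (h2 : s₂ ∈ I.endWeights w ζ (I.right v) y) :
    s₁ + w v + s₂ ∈ I.normalPathWeights w ξ v y := by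
  obtain ⟨x, ⟨-, hvx, hxζ⟩, P, hP, hb, rfl⟩ := h1
  obtain ⟨Q, hQ, hbQ, rfl⟩ := h2
  rw [mem_normalPathWeights]
  have e : P ++ [x] ++ v :: (Q ++ [y]) = (P ++ [x] ++ v :: Q) ++ [y] := by simp
  refine ⟨P ++ [x] ++ v :: Q, e ▸ hP.append_cons hQ (fun z hz => (hb z hz).2)
    (fun z hz => (hbQ z hz).2) hvx (fun q hq => hxζ.trans_le (hbQ q hq).1), ?_, ?_⟩
  · rw [← e]
    intro z hz
    rcases List.mem_append.1 hz with hz | hz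
    · exact mem_between.2 ⟨(hb z hz).1, (hb z hz).2.le⟩
    · rcases List.mem_cons.1 hz with rfl | hz
      · exact hv
      · exact mem_between.2 ⟨(mem_between.1 hv).1.trans (hζ.le.trans (hbQ z hz).1),
          (hbQ z hz).2.le⟩
  · rw [← e, sum_map_append_cons w (P ++ [x])]

theorem mem_endWeights_singleton (I : IntervalRep G) (w : V → ℕ) {c : ℝ} {y : V}
    (hy : I.right y < c) : w y ∈ I.endWeights w (I.left y) c y :=
  ⟨[], I.singleton_normalList y, by simpa using hy, by simp⟩

end

/-! ### ### Special partitions: the separators in `Ξ` and the vertices `π` -/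

section

variable {V : Type*} {G : SimpleGraph V} {κ : ℕ} {A B : Finset V}

/-- Two intervals of `A` through `l_v` would intersect; independence makes the choice in `xi`
unique. -/
theorem IsSpecial.xi_eq {I : IntervalRep G} (h : I.IsSpecial κ A B) {q v : V} (hq : q ∈ A)
    (hv : I.left v ∈ I.interval q) : I.xi A v = I.left q := by
  have hex : ∃ u ∈ A, I.left v ∈ I.interval u := ⟨q, hq, hv⟩
  rw [xi, dif_pos hex]
  obtain ⟨h1, h2⟩ := hex.choose_spec
  by_contra hne
  refine h.indep _ h1 q hq (I.adj_of_le (fun e => hne (e ▸ rfl)) (h2.1.trans hv.2)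
    (hv.1.trans h2.2))

/-- If the vertex `q` with the smallest left endpoint is in `A`, its neighbour `q'` on the path is
in `B`, and by minimality `l_{q'}` lies in the interval of `q`; so `ξ_{q'} = l_q`. -/
theorem IsSpecial.left_mem_Xi {I : IntervalRep G} (h : I.IsSpecial κ A B) {L : List V}
    (hc : L.IsChain G.Adj) (hlen : 2 ≤ L.length) {q : V} (hq : q ∈ L)
    (hmin : ∀ z ∈ L, I.left q ≤ I.left z) : I.left q ∈ I.Xi A B := by
  classical
  rw [Xi, Finset.mem_union]
  rcases h.cover q with hA | hB
  · left
    obtain ⟨q', hq', hadj⟩ := exists_adj_of_isChain hc hq hlen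
    have hq'B : q' ∈ B := (h.cover q').resolve_left fun hA' => h.indep q hA q' hA' hadj
    exact Finset.mem_image.2 ⟨q', hq'B,
      h.xi_eq hA ⟨hmin q' hq', I.left_le_of_adj hadj.symm⟩⟩
  · exact Or.inr (Finset.mem_image_of_mem _ hB)

/-- The three alternatives: the path avoids `v`; `y` alone follows `v`; or a longer path follows
`v`, and `ζ` is its smallest left endpoint. -/
theorem IsSpecial.normalPathWeights_of_lt {I : IntervalRep G} (h : I.IsSpecial κ A B) (w : V → ℕ)
    {ξ : ℝ} {v y : V} (hv : v ∈ I.between ξ v) (hyv : I.right y < I.right v)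
    (hvy : I.left v < I.left y) (s : ℕ) : s ∈ I.normalPathWeights w ξ v y ↔
      s ∈ I.endWeights w ξ (I.right v) y ∨
      (∃ s₁ ∈ I.prefixWeights w ξ v (I.left y), s = s₁ + w v + w y) ∨
      ∃ ζ ∈ I.Xi A B, (I.left v < ζ ∧ ζ ≤ I.left y) ∧ ∃ s₁ ∈ I.prefixWeights w ξ v ζ,
        ∃ s₂ ∈ I.endWeights w ζ (I.right v) y, s = s₁ + w v + s₂ := by
  classical
  constructor
  · intro hs
    obtain ⟨P, hP, hb, rfl⟩ := (I.mem_normalPathWeights w ξ v y s).1 hs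
    by_cases hvP : v ∈ P ++ [y]
    · right
      obtain ⟨S, x, Q, e⟩ := hP.exists_eq_append hvP hyv
      rw [e] at hP hb ⊢
      obtain ⟨hQ, hxQ⟩ := hP.split_rightmost fun z hz => (hb z hz).2.2
      have hvx := (I.left_le_of_adj hP.adj_of_append.symm).lt_of_ne (I.left_ne_right v x)
      rw [sum_map_append_cons]
      -- A single vertex `y` after `v` has no neighbour in its part, so `l_y` need not be in `Ξ`.
      -- This is why the algorithm treats `w(v) + w(y)` separately.
      rcases eq_or_ne Q [] with rfl | hQne
      · exact Or.inl ⟨_, hP.sum_mem_prefixWeights w hb (hxQ y (by simp)), by simp⟩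
      · right
        obtain ⟨q, hq, hmin⟩ := (Q ++ [y]).toFinset.exists_min_image I.left ⟨y, by simp⟩
        rw [List.mem_toFinset] at hq
        have hmin' : ∀ z ∈ Q ++ [y], I.left q ≤ I.left z := fun z hz =>
          hmin z (List.mem_toFinset.2 hz)
        have hnv := (List.nodup_cons.1 (List.nodup_append'.1 hP.nodup).2.1).1
        refine ⟨I.left q, h.left_mem_Xi hQ.greedy.isChain ?_ hq hmin',
          ⟨hvx.trans (hxQ q hq), hmin' y (by simp)⟩, _,
          hP.sum_mem_prefixWeights w hb (hxQ q hq), _, ⟨Q, hQ, fun z hz => ⟨hmin' z hz,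
            (hb z (List.mem_append_right _ (List.mem_cons_of_mem _ hz))).2.2.lt_of_ne
              fun e => hnv (I.right_injective e ▸ hz)⟩, rfl⟩, rfl⟩
        have := List.length_pos_of_ne_nil hQne
        simp only [List.length_append, List.length_singleton]
        omega
    · exact Or.inl ⟨P, hP, fun z hz => ⟨(hb z hz).1, (hb z hz).2.2.lt_of_ne fun e =>
        hvP (I.right_injective e ▸ hz)⟩, rfl⟩
  · rintro (hs | ⟨s₁, h1, rfl⟩ | ⟨ζ, -, ⟨hζ, -⟩, s₁, h1, s₂, h2, rfl⟩)
    · exact I.endWeights_subset w ξ v y hs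
    · exact I.add_add_mem_normalPathWeights w hv hvy h1 (I.mem_endWeights_singleton w hyv)
    · exact I.add_add_mem_normalPathWeights w hv hζ h1 h2

theorem pi_spec (I : IntervalRep G) (B : Finset V) (u v : V) :
    (I.pi B u v = u ∨ I.pi B u v ∈ B ∧ G.Adj u (I.pi B u v) ∧
      I.right u < I.right (I.pi B u v) ∧ I.right (I.pi B u v) < I.right v) ∧
    I.right u ≤ I.right (I.pi B u v) ∧
    ∀ z ∈ B, G.Adj u z → I.right u < I.right z → I.right z < I.right v →
      I.right z ≤ I.right (I.pi B u v) := by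
  classical
  have h := (Finset.exists_max_image
    (insert u (B.filter fun z => G.Adj u z ∧ I.right u < I.right z ∧ I.right z < I.right v))
    I.right (Finset.insert_nonempty _ _)).choose_spec
  have e : I.pi B u v = (Finset.exists_max_image
    (insert u (B.filter fun z => G.Adj u z ∧ I.right u < I.right z ∧ I.right z < I.right v))
    I.right (Finset.insert_nonempty _ _)).choose := by
    unfold pi
    congr!
  rw [← e] at h
  obtain ⟨h1, h2⟩ := h
  refine ⟨?_, h2 u (Finset.mem_insert_self _ _), fun z hz h3 h4 h5 =>
    h2 z (Finset.mem_insert_of_mem (Finset.mem_filter.2 ⟨hz, h3, h4, h5⟩))⟩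
  simpa [Finset.mem_insert, Finset.mem_filter] using h1

theorem right_pi_lt (I : IntervalRep G) (B : Finset V) {u v : V} (h : I.right u < I.right v) :
    I.right (I.pi B u v) < I.right v := by
  rcases (I.pi_spec B u v).1 with e | h1
  · rwa [e]
  · exact h1.2.2.2

/-- Vertices of the path to the right of `x` contain `x` and are adjacent to it. None is in `A`,
since intervals of `A` contain no others, so `π_{x,v}` bounds them. Conversely `π_{x,v}` itself is
before `v`. -/
theorem IsSpecial.endWeights_eq {I : IntervalRep G} (h : I.IsSpecial κ A B) (w : V → ℕ)
    (ξ : ℝ) {v x : V} (hx : I.right x < I.right v) :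
    I.endWeights w ξ (I.right v) x = I.normalPathWeights w ξ (I.pi B x v) x := by
  ext s
  rw [mem_normalPathWeights]
  constructor
  · rintro ⟨P, hP, hb, rfl⟩
    refine ⟨P, hP, fun z hz => mem_between.2 ⟨(hb z hz).1, ?_⟩, rfl⟩
    obtain ⟨-, h1, h2⟩ := I.pi_spec B x v
    rcases le_or_gt (I.right z) (I.right x) with hzx | hzx
    · exact hzx.trans h1
    · refine h2 z ((h.cover z).resolve_left fun hA => ?_) (hP.adj_last hz hzx).symm hzx (hb z hz).2
      exact h.not_subset z hA x (by rintro rfl; exact lt_irrefl _ hzx)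
        (Set.Icc_subset_Icc (hP.left_lt_left hz hzx).le hzx.le)
  · rintro ⟨P, hP, hb, rfl⟩
    exact ⟨P, hP, fun z hz => ⟨(hb z hz).1, (hb z hz).2.2.trans_lt (I.right_pi_lt B hx)⟩, rfl⟩

end

end IntervalRep

/-! ### Maxima of sets of weights -/

/-- `c` is the maximum of `S`, where the maximum of the empty set is `⊥`. -/
def IsMaxOf (c : WithBot ℕ) (S : Set ℕ) : Prop :=
  (∀ s ∈ S, (s : WithBot ℕ) ≤ c) ∧ ∀ m : ℕ, c = m → m ∈ S

theorem IsMaxOf.congr {c : WithBot ℕ} {S T : Set ℕ} (h : IsMaxOf c S) (e : ∀ s, s ∈ T ↔ s ∈ S) :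
    IsMaxOf c T :=
  ⟨fun s hs => h.1 s ((e s).1 hs), fun m hm => (e m).2 (h.2 m hm)⟩

theorem isMaxOf_coe (n : ℕ) : IsMaxOf (n : WithBot ℕ) {n} :=
  ⟨by simp, fun m hm => (WithBot.coe_injective hm).symm⟩

theorem IsMaxOf.max {c d : WithBot ℕ} {S T : Set ℕ} (hc : IsMaxOf c S) (hd : IsMaxOf d T) :
    IsMaxOf (max c d) (S ∪ T) := by
  refine ⟨?_, fun m hm => ?_⟩
  · rintro s (hs | hs)
    · exact (hc.1 s hs).trans (le_max_left _ _)
    · exact (hd.1 s hs).trans (le_max_right _ _)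
  · rcases max_choice c d with h | h
    · exact Or.inl (hc.2 m (h.symm.trans hm))
    · exact Or.inr (hd.2 m (h.symm.trans hm))

theorem IsMaxOf.add {c d : WithBot ℕ} {S T : Set ℕ} (hc : IsMaxOf c S) (hd : IsMaxOf d T) :
    IsMaxOf (c + d) {s | ∃ s₁ ∈ S, ∃ s₂ ∈ T, s = s₁ + s₂} := by
  refine ⟨?_, fun m hm => ?_⟩
  · rintro s ⟨s₁, h1, s₂, h2, rfl⟩
    rw [Nat.cast_add]
    exact add_le_add (hc.1 _ h1) (hd.1 _ h2)
  · cases c with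
    | bot => simp at hm
    | coe c =>
      cases d with
      | bot => simp at hm
      | coe d => exact ⟨c, hc.2 c rfl, d, hd.2 d rfl, WithBot.coe_injective hm.symm⟩

theorem isMaxOf_finsetSup {α : Type*} (F : Finset α) (f : α → WithBot ℕ) (S : α → Set ℕ)
    (h : ∀ x ∈ F, IsMaxOf (f x) (S x)) : IsMaxOf (F.sup f) {s | ∃ x ∈ F, s ∈ S x} := by
  refine ⟨?_, fun m hm => ?_⟩
  · rintro s ⟨x, hx, hs⟩
    exact ((h x hx).1 s hs).trans (Finset.le_sup hx)
  · have hne : F.Nonempty := by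
      rw [Finset.nonempty_iff_ne_empty]
      rintro rfl
      simp at hm
    obtain ⟨x, hx, e⟩ := Finset.exists_mem_eq_sup F hne f
    exact ⟨x, hx, (h x hx).2 m (e.symm.trans hm)⟩

theorem IsMaxOf.exists_isGreatest {c : WithBot ℕ} {S : Set ℕ} (h : IsMaxOf c S)
    (hS : S.Nonempty) : ∃ m : ℕ, c = (m : WithBot ℕ) ∧ IsGreatest S m := by
  obtain ⟨s, hs⟩ := hS
  cases c with
  | bot => exact absurd (h.1 s hs) (by simp)
  | coe c => exact ⟨c, rfl, h.2 c rfl, fun s hs => WithBot.coe_le_coe.1 (h.1 s hs)⟩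

/-! ### Loops -/

theorem foldl_invariant {τ α : Type*} {f : τ → α → τ} {P : τ → Prop} {L : List α}
    (hf : ∀ W, ∀ a ∈ L, P W → P (f W a)) {W : τ} (hW : P W) : P (L.foldl f W) := by
  induction L generalizing W with
  | nil => exact hW
  | cons a L ih =>
    exact ih (fun W b hb => hf W b (List.mem_cons_of_mem _ hb)) (hf W a (by simp) hW)

/-- A rule for loops whose order does not matter: `Inv` holds throughout, `Pre b` survives until the
turn of `b`, and `Post b` survives after it. -/
theorem foldl_post {τ α : Type*} {f : τ → α → τ} {Inv : τ → Prop} {Pre Post : α → τ → Prop}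
    {L : List α} (hn : L.Nodup) (hInv : ∀ W, ∀ a ∈ L, Inv W → Inv (f W a))
    (hPre : ∀ W, ∀ a ∈ L, ∀ b ∈ L, b ≠ a → Pre b W → Pre b (f W a))
    (hPost : ∀ W, ∀ a ∈ L, Inv W → Pre a W → Post a (f W a))
    (hkeep : ∀ W, ∀ a ∈ L, ∀ b ∈ L, b ≠ a → Post b W → Post b (f W a))
    {W : τ} (hW : Inv W) (hWP : ∀ a ∈ L, Pre a W) : ∀ a ∈ L, Post a (L.foldl f W) := by
  induction L generalizing W with
  | nil => simp
  | cons a L ih =>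
    obtain ⟨haL, hnL⟩ := List.nodup_cons.1 hn
    have hne : ∀ b ∈ L, b ≠ a := by
      rintro b hb rfl
      exact haL hb
    intro b hb
    rcases List.mem_cons.1 hb with rfl | hb
    · exact foldl_invariant (P := Post b)
        (fun W c hc => hkeep W c (List.mem_cons_of_mem _ hc) b (by simp) (hne c hc).symm)
        (hPost W b (by simp) hW (hWP b (by simp)))
    · exact ih hnL (fun W c hc => hInv W c (List.mem_cons_of_mem _ hc))
        (fun W c hc d hd => hPre W c (List.mem_cons_of_mem _ hc) d (List.mem_cons_of_mem _ hd))
        (fun W c hc => hPost W c (List.mem_cons_of_mem _ hc))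
        (fun W c hc d hd => hkeep W c (List.mem_cons_of_mem _ hc) d (List.mem_cons_of_mem _ hd))
        (hInv W a (by simp) hW) (fun c hc => hPre W a (by simp) c (List.mem_cons_of_mem _ hc)
          (hne c hc) (hWP c (List.mem_cons_of_mem _ hc))) b hb

namespace Table

variable {U : Type*}

theorem assign_same (W : Table U) (ξ : ℝ) (v y : U) (c : WithBot ℕ) :
    W.assign ξ v y c ξ v y = c := by
  simp [assign]

theorem assign_of_ne (W : Table U) {ξ ξ' : ℝ} {v v' y y' : U} (c : WithBot ℕ)
    (h : ¬ (ξ' = ξ ∧ v' = v ∧ y' = y)) : W.assign ξ v y c ξ' v' y' = W ξ' v' y' := by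
  simp [assign, h]

end Table

namespace IntervalRep

/-! ### Correctness of the table -/

section

variable {U : Type*} {G : SimpleGraph U}

theorem initStep_of_ne (I : IntervalRep G) (w : U → ℕ) (B : Finset U) (ys : List U)
    {ξ ξ' : ℝ} {v v' y' : U} (W : Table U) (h : ¬ (ξ' = ξ ∧ v' = v)) :
    I.initStep w B ys ξ v W ξ' v' y' = W ξ' v' y' := by
  unfold initStep
  refine foldl_invariant (P := fun W' : Table U => W' ξ' v' y' = W ξ' v' y') ?_ ?_
  · intro W' y _ h'
    exact (W'.assign_of_ne _ fun e => h ⟨e.1, e.2.1⟩).trans h'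
  · split_ifs
    · exact W.assign_of_ne _ fun e => h ⟨e.1, e.2.1⟩
    · rfl

/-- The entries `W_ξ(v, ·)` of the table `W` are correct. -/
def CorrectAt (I : IntervalRep G) (w : U → ℕ) (W : Table U) (ξ : ℝ) (v : U) : Prop :=
  ∀ y ∈ I.between ξ v, (y = v ∨ G.Adj v y) →
    IsMaxOf (W ξ v y) (I.normalPathWeights w ξ v y)

/-- The entries of the table `W` for `v` are correct. -/
def Correct (I : IntervalRep G) (w : U → ℕ) (Ξ : Finset ℝ) (W : Table U) (v : U) : Prop :=
  ∀ ξ ∈ Ξ, ξ < I.right v → I.CorrectAt w W ξ v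

/-- The entries of the table `W` for all vertices to the left of `v` are correct. -/
def CorrectBefore (I : IntervalRep G) (w : U → ℕ) (Ξ : Finset ℝ) (W : Table U) (v : U) : Prop :=
  ∀ u, I.right u < I.right v → I.Correct w Ξ W u

theorem Correct.congr {I : IntervalRep G} {w : U → ℕ} {Ξ : Finset ℝ} {W W' : Table U} {v : U}
    (h : I.Correct w Ξ W v) (e : ∀ ξ y, W' ξ v y = W ξ v y) : I.Correct w Ξ W' v := by
  intro ξ h1 h2 y h3 h4
  rw [e]
  exact h ξ h1 h2 y h3 h4

theorem CorrectBefore.congr {I : IntervalRep G} {w : U → ℕ} {Ξ : Finset ℝ} {W W' : Table U}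
    {v : U} (h : I.CorrectBefore w Ξ W v) (e : ∀ ξ u y, u ≠ v → W' ξ u y = W ξ u y) :
    I.CorrectBefore w Ξ W' v := fun u hu =>
  (h u hu).congr fun ξ y => e ξ u y (by rintro rfl; exact lt_irrefl _ hu)

theorem right_lt_of_mem_between {I : IntervalRep G} {ξ : ℝ} {v y : U} (hy : y ∈ I.between ξ v)
    (hvy : G.Adj v y) : I.right y < I.right v :=
  hy.2.2.lt_of_ne fun e => hvy.ne (I.right_injective e).symm

variable {κ : ℕ} {A B : Finset U}

/-- The entry read here belongs to `π_{x,v}`, which is strictly before `v`, and `endWeights_eq`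
identifies the set it maximizes. -/
theorem CorrectBefore.isMaxOf_pi {I : IntervalRep G} (h : I.IsSpecial κ A B) {w : U → ℕ}
    {W : Table U} {v : U} (hW : I.CorrectBefore w (I.Xi A B) W v) {ξ : ℝ} (hξ : ξ ∈ I.Xi A B)
    {x : U} (hξx : ξ ≤ I.left x) (hx : I.right x < I.right v) :
    IsMaxOf (W ξ (I.pi B x v) x) (I.endWeights w ξ (I.right v) x) := by
  rw [h.endWeights_eq w ξ hx]
  obtain ⟨h1, h2, -⟩ := I.pi_spec B x v
  refine hW _ (I.right_pi_lt B hx) ξ hξ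
    (hξx.trans_lt ((I.left_lt_right x).trans_le h2)) x (mem_between.2 ⟨hξx, h2⟩) ?_
  rcases h1 with e | h1
  · exact Or.inl e.symm
  · exact Or.inr h1.2.1.symm

variable [Fintype U]

theorem zetaLoop_of_ne (I : IntervalRep G) (w : U → ℕ) (B : Finset U) (zs : List ℝ)
    {ξ ξ' : ℝ} {v v' y y' : U} (W : Table U) (h : ¬ (ξ' = ξ ∧ v' = v ∧ y' = y)) :
    I.zetaLoop w B zs ξ v y W ξ' v' y' = W ξ' v' y' := by
  unfold zetaLoop
  refine foldl_invariant (P := fun W' : Table U => W' ξ' v' y' = W ξ' v' y') ?_ rfl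
  intro W' ζ _ h'
  exact (W'.assign_of_ne _ h).trans h'

theorem offDiagStep_of_ne (I : IntervalRep G) (w : U → ℕ) (B : Finset U) (zs : List ℝ)
    {ξ ξ' : ℝ} {v v' y y' : U} (W : Table U) (h : ¬ (ξ' = ξ ∧ v' = v ∧ y' = y)) :
    I.offDiagStep w B zs ξ v y W ξ' v' y' = W ξ' v' y' := by
  unfold offDiagStep
  split_ifs
  · exact W.assign_of_ne _ h
  · rw [zetaLoop_of_ne _ _ _ _ _ h, W.assign_of_ne _ h]

theorem diagStep_of_ne (I : IntervalRep G) (w : U → ℕ) (B : Finset U)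
    {ξ ξ' : ℝ} {v v' y' : U} (W : Table U) (h : ¬ (ξ' = ξ ∧ v' = v ∧ y' = v)) :
    I.diagStep w B ξ v W ξ' v' y' = W ξ' v' y' := by
  unfold diagStep
  split_ifs
  · exact W.assign_of_ne _ h
  · rfl

theorem iteration_of_ne (I : IntervalRep G) (w : U → ℕ) (B : Finset U) (zs : List ℝ)
    (ys : List U) {ξ ξ' : ℝ} {v v' y' : U} (W : Table U) (h : ¬ (ξ' = ξ ∧ v' = v)) :
    I.iteration w B zs ys v ξ W ξ' v' y' = W ξ' v' y' := by
  unfold iteration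
  refine foldl_invariant (P := fun W' : Table U => W' ξ' v' y' = W ξ' v' y') ?_ ?_
  · intro W' y _ h'
    exact (I.offDiagStep_of_ne w B zs W' fun e => h ⟨e.1, e.2.1⟩).trans h'
  · rw [diagStep_of_ne _ _ _ _ fun e => h ⟨e.1, e.2.1⟩, initStep_of_ne _ _ _ _ _ h]

theorem CorrectBefore.isMaxOf_maxEntry {I : IntervalRep G} (h : I.IsSpecial κ A B) {w : U → ℕ}
    {W : Table U} {v : U} (hW : I.CorrectBefore w (I.Xi A B) W v) {ξ : ℝ} (hξ : ξ ∈ I.Xi A B)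
    {q : ℝ} (hq : q ≤ I.right v) :
    IsMaxOf (I.maxEntry B W ξ v q) (I.prefixWeights w ξ v q) := by
  unfold maxEntry
  refine (isMaxOf_finsetSup _ _ (fun x => I.endWeights w ξ (I.right v) x)
    fun x hx => ?_).congr fun s => ?_
  · simp only [Finset.mem_filter, Finset.mem_univ, true_and] at hx
    obtain ⟨hx1, -, hx2⟩ := hx
    exact hW.isMaxOf_pi h hξ hx1.1 (hx2.trans_le hq)
  · simp [prefixWeights]

/-- The loop writes only to its accumulator `W_ξ(v, y)`; all other entries it reads belong to
earlier vertices and stay correct. The set `S` collects the weights accounted for so far. -/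
theorem CorrectBefore.isMaxOf_zetaLoop {I : IntervalRep G} (h : I.IsSpecial κ A B) {w : U → ℕ}
    {W : Table U} {v : U} (hW : I.CorrectBefore w (I.Xi A B) W v) {ξ : ℝ} (hξ : ξ ∈ I.Xi A B)
    {y : U} (hy : I.right y < I.right v) {zs : List ℝ} (hzs : ∀ ζ ∈ zs, ζ ∈ I.Xi A B)
    {S : Set ℕ} (hS : IsMaxOf (W ξ v y) S) :
    IsMaxOf (I.zetaLoop w B zs ξ v y W ξ v y) (S ∪ {s | ∃ ζ ∈ zs,
      (I.left v < ζ ∧ ζ ≤ I.left y) ∧ ∃ s₁ ∈ I.prefixWeights w ξ v ζ,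
        ∃ s₂ ∈ I.endWeights w ζ (I.right v) y, s = s₁ + w v + s₂}) := by
  induction zs generalizing W S with
  | nil => simpa [zetaLoop] using hS
  | cons ζ zs ih =>
    have hzs' := fun ζ' h' => hzs ζ' (List.mem_cons_of_mem ζ h')
    by_cases hζ : I.left v < ζ ∧ ζ ≤ I.left y
    · have e : I.zetaLoop w B (ζ :: zs) ξ v y W = I.zetaLoop w B zs ξ v y
          (W.assign ξ v y (max (W ξ v y)
            (I.maxEntry B W ξ v ζ + (w v : WithBot ℕ) + W ζ (I.pi B y v) y))) := by
        simp [zetaLoop, hζ]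
      rw [e]
      have hζv : ζ ≤ I.right v := hζ.2.trans ((I.left_lt_right y).trans hy).le
      have hmax := hS.max (((hW.isMaxOf_maxEntry h hξ hζv).add (isMaxOf_coe (w v))).add
        (hW.isMaxOf_pi h (hzs ζ (by simp)) hζ.2 hy))
      refine (ih (hW.congr fun ξ' u y' hu => W.assign_of_ne _ fun e => hu e.2.1) hzs'
        (by rw [W.assign_same]; exact hmax)).congr fun s => ?_
      simp only [Set.mem_union, Set.mem_ofPred_eq, List.mem_cons, Set.mem_singleton_iff,
        exists_eq_left, exists_eq_or_imp, or_assoc]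
      refine or_congr_right (or_congr_left ?_)
      constructor
      · rintro ⟨-, s₁, h1, s₂, h2, rfl⟩
        exact ⟨_, ⟨s₁, h1, rfl⟩, s₂, h2, rfl⟩
      · rintro ⟨_, ⟨s₁, h1, rfl⟩, s₂, h2, rfl⟩
        exact ⟨hζ, s₁, h1, s₂, h2, rfl⟩
    · have e : I.zetaLoop w B (ζ :: zs) ξ v y W = I.zetaLoop w B zs ξ v y W := by
        simp [zetaLoop, hζ]
      rw [e]
      refine (ih hW hzs' hS).congr fun s => ?_
      simp only [Set.mem_union, Set.mem_ofPred_eq, List.mem_cons, exists_eq_or_imp, hζ, false_and,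
        false_or]

theorem CorrectBefore.isMaxOf_offDiagStep {I : IntervalRep G} (h : I.IsSpecial κ A B) {w : U → ℕ}
    {W : Table U} {v : U} (hW : I.CorrectBefore w (I.Xi A B) W v) {ξ : ℝ} (hξ : ξ ∈ I.Xi A B)
    {y : U} (hy : y ∈ I.between ξ v) (hvy : G.Adj v y) {zs : List ℝ}
    (hzs : ∀ ζ, ζ ∈ zs ↔ ζ ∈ I.Xi A B)
    (hS : IsMaxOf (W ξ v y) (I.endWeights w ξ (I.right v) y)) :
    IsMaxOf (I.offDiagStep w B zs ξ v y W ξ v y) (I.normalPathWeights w ξ v y) := by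
  have hyv := right_lt_of_mem_between hy hvy
  unfold offDiagStep
  split_ifs with hc
  · rw [W.assign_same, I.normalPathWeights_eq_endWeights w hyv hc]
    exact hW.isMaxOf_pi h hξ hy.1 hyv
  · simp only [not_or, not_not, not_lt] at hc
    -- Left endpoints are distinct, so the remaining case has strict nesting, as
    -- `normalPathWeights_of_lt` requires.
    have hvl : I.left v < I.left y := hc.1.lt_of_ne fun e => hvy.ne (I.left_injective e)
    have hmax := hS.max (((hW.isMaxOf_maxEntry h hξ
      ((I.left_lt_right y).trans hyv).le).add (isMaxOf_coe (w v))).add (isMaxOf_coe (w y)))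
    refine (CorrectBefore.isMaxOf_zetaLoop h
      (hW.congr fun ξ' u y' hu => W.assign_of_ne _ fun e => hu e.2.1) hξ hyv
      (fun ζ hζ => (hzs ζ).1 hζ) (by rw [W.assign_same]; exact hmax)).congr fun s => ?_
    rw [h.normalPathWeights_of_lt w hc.2 hyv hvl]
    simp only [Set.mem_union, Set.mem_ofPred_eq, Set.mem_singleton_iff, exists_eq_left, hzs,
      or_assoc]
    refine or_congr_right (or_congr_left ?_)
    constructor
    · rintro ⟨s₁, h1, rfl⟩
      exact ⟨_, ⟨s₁, h1, rfl⟩, rfl⟩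
    · rintro ⟨_, ⟨s₁, h1, rfl⟩, rfl⟩
      exact ⟨s₁, h1, rfl⟩

theorem CorrectBefore.correctAt_iteration {I : IntervalRep G} (h : I.IsSpecial κ A B) {w : U → ℕ}
    {W : Table U} {v : U} (hW : I.CorrectBefore w (I.Xi A B) W v) {ξ : ℝ} (hξ : ξ ∈ I.Xi A B)
    {zs : List ℝ} (hzs : ∀ ζ, ζ ∈ zs ↔ ζ ∈ I.Xi A B) {ys : List U}
    (hys : Enumerates ys Finset.univ) :
    I.CorrectAt w (I.iteration w B zs ys v ξ W) ξ v := by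
  classical
  have hmem : ∀ (y : U), y ∈ (ys.filter fun y => decide (y ∈ I.between ξ v ∧ G.Adj v y)) ↔
      y ∈ I.between ξ v ∧ G.Adj v y := by
    intro y
    simp [hys.2]
  have hnd : (ys.filter fun y => decide (y ∈ I.between ξ v ∧ G.Adj v y)).Nodup := hys.1.filter _
  -- the initialization
  obtain ⟨W₁, hW₁⟩ : ∃ W₁, W₁ = I.initStep w B ys ξ v W := ⟨_, rfl⟩
  have hB₁ : I.CorrectBefore w (I.Xi A B) W₁ v := hW.congr fun ξ' u y hu => by
    rw [hW₁, initStep_of_ne _ _ _ _ _ fun e => hu e.2]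
  have hd₁ : v ∈ I.between ξ v → IsMaxOf (W₁ ξ v v) {w v} := by
    intro hv
    rw [hW₁]
    unfold initStep
    refine foldl_invariant (P := fun W' : Table U => IsMaxOf (W' ξ v v) {w v}) ?_ ?_
    · intro W' y hy h'
      rw [W'.assign_of_ne _ fun e => ((hmem y).1 (by convert hy)).2.ne e.2.2]
      exact h'
    · rw [if_pos hv, W.assign_same]
      exact isMaxOf_coe _
  have ho₁ : ∀ y ∈ (ys.filter fun y => decide (y ∈ I.between ξ v ∧ G.Adj v y)),
      IsMaxOf (W₁ ξ v y) (I.endWeights w ξ (I.right v) y) := by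
    rw [hW₁]
    unfold initStep
    convert foldl_post (Inv := fun W' => I.CorrectBefore w (I.Xi A B) W' v)
      (Pre := fun _ _ => True)
      (Post := fun y (W' : Table U) => IsMaxOf (W' ξ v y) (I.endWeights w ξ (I.right v) y))
      hnd (f := fun W y => W.assign ξ v y (W ξ (I.pi B y v) y))
      (fun W' y _ h' => h'.congr fun ξ' u y' hu => W'.assign_of_ne _ fun e => hu e.2.1)
      (fun _ _ _ _ _ _ h => h) (fun W' y hy h' _ => ?_) (fun W' a _ b _ hab hb => ?_)
      (W := if v ∈ I.between ξ v then W.assign ξ v v (w v : WithBot ℕ) else W) ?_ ?_ using 4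
    · rw [W'.assign_same]
      obtain ⟨hy1, hy2⟩ := (hmem y).1 hy
      exact h'.isMaxOf_pi h hξ hy1.1 (right_lt_of_mem_between hy1 hy2)
    · rw [W'.assign_of_ne _ fun e => hab e.2.2]
      exact hb
    · split_ifs
      · exact hW.congr fun ξ' u y' hu => W.assign_of_ne _ fun e => hu e.2.1
      · exact hW
    · exact fun _ _ => trivial
  -- the entry `W_ξ(v, v)`
  obtain ⟨W₂, hW₂⟩ : ∃ W₂, W₂ = I.diagStep w B ξ v W₁ := ⟨_, rfl⟩
  have hB₂ : I.CorrectBefore w (I.Xi A B) W₂ v := hB₁.congr fun ξ' u y hu => by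
    rw [hW₂, diagStep_of_ne _ _ _ _ fun e => hu e.2.1]
  have hd₂ : v ∈ I.between ξ v → IsMaxOf (W₂ ξ v v) (I.normalPathWeights w ξ v v) := by
    intro hv
    rw [hW₂]
    unfold diagStep
    rw [if_pos hv, W₁.assign_same]
    refine ((hd₁ hv).max ((hB₁.isMaxOf_maxEntry h hξ le_rfl).add (isMaxOf_coe (w v)))).congr
      fun s => ?_
    rw [I.normalPathWeights_self w hv]
    simp
  have ho₂ : ∀ y ∈ (ys.filter fun y => decide (y ∈ I.between ξ v ∧ G.Adj v y)),
      IsMaxOf (W₂ ξ v y) (I.endWeights w ξ (I.right v) y) := by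
    intro y hy
    rw [hW₂, diagStep_of_ne _ _ _ _ fun e => ((hmem y).1 hy).2.ne e.2.2.symm]
    exact ho₁ y hy
  -- the remaining entries
  have hiter : I.iteration w B zs ys v ξ W =
      (ys.filter fun y => decide (y ∈ I.between ξ v ∧ G.Adj v y)).foldl
        (fun W y => I.offDiagStep w B zs ξ v y W) W₂ := by
    rw [hW₂, hW₁]
    unfold iteration
    congr!
  rw [hiter]
  intro y hy hvy
  rcases eq_or_ne y v with rfl | hne
  · refine foldl_invariant
      (P := fun W' : Table U => IsMaxOf (W' ξ y y) (I.normalPathWeights w ξ y y)) ?_ (hd₂ hy)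
    intro W' y' hy' h'
    rw [offDiagStep_of_ne _ _ _ _ _ fun e => ((hmem y').1 hy').2.ne e.2.2]
    exact h'
  · refine foldl_post (Inv := fun W' => I.CorrectBefore w (I.Xi A B) W' v)
      (Pre := fun y (W' : Table U) => IsMaxOf (W' ξ v y) (I.endWeights w ξ (I.right v) y))
      (Post := fun y (W' : Table U) => IsMaxOf (W' ξ v y) (I.normalPathWeights w ξ v y))
      hnd (fun W' y _ h' => h'.congr fun ξ' u y' hu =>
        offDiagStep_of_ne _ _ _ _ _ fun e => hu e.2.1)
      (fun W' a _ b _ hab hb => ?_)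
      (fun W' y hy h' h'' => h'.isMaxOf_offDiagStep h hξ ((hmem y).1 hy).1 ((hmem y).1 hy).2
        hzs h'')
      (fun W' a _ b _ hab hb => ?_) hB₂ ho₂ y ((hmem y).2 ⟨hy, hvy.resolve_left hne⟩)
    all_goals
      rw [offDiagStep_of_ne _ _ _ _ _ fun e => hab e.2.2]
      exact hb

theorem IsSpecial.correct_runTable {I : IntervalRep G} (h : I.IsSpecial κ A B) (w : U → ℕ)
    {xs zs : List ℝ} {ys vs : List U} (hxs : Enumerates xs (I.Xi A B))
    (hzs : Enumerates zs (I.Xi A B)) (hys : Enumerates ys Finset.univ)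
    (hvs : I.IsRightEndpointOrdering vs) (v : U) :
    I.Correct w (I.Xi A B) (I.runTable w B vs xs zs ys) v := by
  classical
  obtain ⟨hall, hsort⟩ := hvs
  -- The invariant: vertices no longer waiting in the list have correct entries. It is vacuous at
  -- the start, when every vertex is listed, and sortedness turns it into `CorrectBefore` for the
  -- head.
  have key : ∀ (vs : List U) (W : Table U), vs.Pairwise (fun u v => I.right u < I.right v) →
      (∀ u, u ∉ vs → I.Correct w (I.Xi A B) W u) → ∀ u, I.Correct w (I.Xi A B)
        (vs.foldl (fun W v => (xs.filter fun ξ => decide (ξ < I.right v)).foldl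
          (fun W ξ => I.iteration w B zs ys v ξ W) W) W) u := by
    intro vs
    induction vs with
    | nil => exact fun W _ hW u => hW u (by simp)
    | cons v vs ih =>
      intro W hs hW
      obtain ⟨hs1, hs2⟩ := List.pairwise_cons.1 hs
      rw [List.foldl_cons]
      have hbefore : I.CorrectBefore w (I.Xi A B) W v := fun u hu => hW u fun hmem => by
        rcases List.mem_cons.1 hmem with rfl | hmem
        · exact lt_irrefl _ hu
        · exact lt_asymm hu (hs1 u hmem)
      refine ih _ hs2 fun u hu => ?_
      rcases eq_or_ne u v with rfl | hne
      · intro ξ hξ hξu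
        refine foldl_post (Inv := fun W' => I.CorrectBefore w (I.Xi A B) W' u)
          (Pre := fun _ _ => True) (Post := fun ξ W' => I.CorrectAt w W' ξ u)
          (hxs.1.filter _)
          (fun W' ξ' _ h' => h'.congr fun _ u' _ hu' =>
            iteration_of_ne _ _ _ _ _ _ fun e => hu' e.2)
          (fun _ _ _ _ _ _ h => h)
          (fun W' ξ' hξ' h' _ => h'.correctAt_iteration h
            ((hxs.2 _).1 (List.mem_of_mem_filter hξ')) hzs.2 hys)
          (fun W' ξ₁ _ ξ₂ _ hne h' y hy hyu => ?_)
          hbefore (fun _ _ => trivial) ξ (by simp [hxs.2, hξ, hξu])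
        change IsMaxOf (I.iteration w B zs ys u ξ₁ W' ξ₂ u y) _
        rw [iteration_of_ne _ _ _ _ _ _ fun e => hne e.1]
        exact h' y hy hyu
      · refine foldl_invariant (P := fun W' => I.Correct w (I.Xi A B) W' u) ?_
          (hW u (by simp [hne, hu]))
        intro W' ξ _ h'
        exact h'.congr fun _ _ => iteration_of_ne _ _ _ _ _ _ fun e => hne e.2
  convert key vs (fun _ _ _ => ⊥) hsort (fun u hu => absurd (hall u) hu) v using 1
  unfold runTable
  congr!

end

end IntervalRep

namespace IntervalRep

/-! ### The dummy vertex -/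

section

variable {V : Type*} {G : SimpleGraph V}

theorem IsSpecial.addDummy {I : IntervalRep G} {κ : ℕ} {A B : Finset V} (h : I.IsSpecial κ A B)
    {a b : ℝ} (hab : a < b) (hb : ∀ v, b < I.left v) :
    (I.addDummy a b hab hb).IsSpecial (κ + 1) (dummyA A) (dummyB B) where
  disjoint := by
    rw [Finset.disjoint_left]
    intro v hA hB
    obtain ⟨v, hv, rfl⟩ := Finset.mem_map.1 hA
    exact Finset.disjoint_left.1 h.disjoint hv (Finset.some_mem_insertNone.1 hB)
  cover v := by
    cases v with
    | none => exact Or.inr Finset.none_mem_insertNone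
    | some v =>
      exact (h.cover v).imp (fun hv => Finset.mem_map.2 ⟨v, hv, rfl⟩)
        fun hv => Finset.some_mem_insertNone.2 hv
  indep u hu v hv := by
    obtain ⟨u, hu', rfl⟩ := Finset.mem_map.1 hu
    obtain ⟨v, hv', rfl⟩ := Finset.mem_map.1 hv
    exact fun hadj => h.indep u hu' v hv' ((dummyGraph_adj_some G u v).1 hadj)
  not_subset v hv u hne hsub := by
    obtain ⟨v, hv', rfl⟩ := Finset.mem_map.1 hv
    cases u with
    | none =>
      have h1 : I.left v ≤ a := (hsub (Set.left_mem_Icc.2 hab.le)).1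
      linarith [hb v]
    | some u => exact h.not_subset v hv' u (fun e => hne (e ▸ rfl)) hsub
  card_le := by
    rw [dummyB, Finset.card_insertNone]
    exact Nat.add_le_add_right h.card_le 1

theorem IsRightEndpointOrdering.addDummy {I : IntervalRep G} {σ : List V}
    (h : I.IsRightEndpointOrdering σ) {a b : ℝ} (hab : a < b) (hb : ∀ v, b < I.left v) :
    (I.addDummy a b hab hb).IsRightEndpointOrdering (none :: σ.map some) := by
  constructor
  · intro v
    cases v with
    | none => simp
    | some v => simpa using h.1 v
  · refine List.pairwise_cons.2 ⟨fun u hu => ?_, List.pairwise_map.2 h.2⟩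
    obtain ⟨u, -, rfl⟩ := List.mem_map.1 hu
    exact (hb u).trans (I.left_lt_right u)

theorem exists_eq_map_some {α : Type*} {L : List (Option α)} (h : ∀ z ∈ L, z ≠ none) :
    ∃ M : List α, L = M.map some := by
  induction L with
  | nil => exact ⟨[], rfl⟩
  | cons a L ih =>
    obtain ⟨M, rfl⟩ := ih fun z hz => h z (List.mem_cons_of_mem _ hz)
    obtain ⟨x, rfl⟩ := Option.ne_none_iff_exists'.1 (h a (by simp))
    exact ⟨x :: M, rfl⟩

/-- The weights of the paths of `G` are the weights of the normal paths of the augmented graph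
that avoid the dummy vertex, grouped by their rightmost vertices. -/
theorem exists_path_weight_iff (I : IntervalRep G) (w : V → ℕ) {a b : ℝ} (hab : a < b)
    (hb : ∀ v, b < I.left v) (s : ℕ) :
    (∃ (u v : V) (p : G.Walk u v), p.IsPath ∧ s = pathWeight w p) ↔
      ∃ (v : V) (y : Option V), (y = some v ∨ ((I.addDummy a b hab hb).right y < I.right v ∧
        (dummyGraph G).Adj (some v) y)) ∧
        s ∈ (I.addDummy a b hab hb).normalPathWeights (dummyWeight w) a (some v) y := by
  classical
  have hsum : ∀ L : List V, ((L.map some).map (dummyWeight w)).sum = (L.map w).sum := by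
    intro L
    rw [List.map_map]
    rfl
  constructor
  · rintro ⟨u, v, p, hp, rfl⟩
    have hchain : (p.support.map some).IsChain (dummyGraph G).Adj :=
      (List.isChain_map _).2 (p.isChain_adj_support.imp fun x y h =>
        (dummyGraph_adj_some G x y).2 h)
    obtain ⟨M, hperm, hM⟩ := (I.addDummy a b hab hb).exists_normalList_perm hchain
      (hp.support_nodup.map (Option.some_injective V))
    have hne : M ≠ [] := by
      rintro rfl
      simpa using hperm.length_eq
    -- The rightmost vertex of the path determines the graph `G_a(x)` in which it is counted; its
    -- last vertex is then `x` or a neighbour of `x`.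
    obtain ⟨z, hz, hmax⟩ := M.toFinset.exists_max_image (I.addDummy a b hab hb).right
      (by simpa [List.toFinset_nonempty_iff] using hne)
    rw [List.mem_toFinset] at hz
    obtain ⟨x, -, rfl⟩ := List.mem_map.1 (hperm.subset hz)
    obtain ⟨P, y, rfl⟩ := (List.eq_nil_or_concat M).resolve_left hne
    rw [List.concat_eq_append] at *
    refine ⟨x, y, ?_, (mem_normalPathWeights _ _ _ _ _ _).2 ⟨P, hM, fun z hz' => ?_, ?_⟩⟩
    · rcases eq_or_ne y (some x) with e | e
      · exact Or.inl e
      · have hlt := (hmax y (by simp)).lt_of_ne fun e' =>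
          e ((I.addDummy a b hab hb).right_injective e')
        exact Or.inr ⟨hlt, hM.adj_last hz hlt⟩
    · obtain ⟨t, -, rfl⟩ := List.mem_map.1 (hperm.subset hz')
      exact mem_between.2 ⟨(hab.trans (hb t)).le, hmax _ (List.mem_toFinset.2 hz')⟩
    · rw [pathWeight, (hperm.map _).sum_eq, hsum]
  · rintro ⟨v, y, hy, hs⟩
    obtain ⟨P, hP, -, rfl⟩ := (mem_normalPathWeights _ _ _ _ _ _).1 hs
    have hynone : y ≠ none := by
      rintro rfl
      rcases hy with hy | hy
      · cases hy
      · exact dummyGraph_not_adj_none G _ hy.2.symm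
    -- The dummy vertex is isolated, so a path through it consists of it alone and ends there, which
    -- is excluded.
    obtain ⟨L, hL⟩ := exists_eq_map_some (L := P ++ [y]) (by
      rintro z hz rfl
      rcases eq_or_ne P [] with rfl | hne
      · exact hynone (List.mem_singleton.1 hz).symm
      · obtain ⟨q, -, hq⟩ := exists_adj_of_isChain hP.greedy.isChain hz (by
          have := List.length_pos_of_ne_nil hne
          simp only [List.length_append, List.length_singleton]
          omega)
        exact dummyGraph_not_adj_none G _ hq)
    have hLne : L ≠ [] := by
      rintro rfl
      simp at hL
    have hc := hP.greedy.isChain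
    have hn := hP.nodup
    rw [hL] at hc hn
    obtain ⟨p, hp⟩ := exists_walk_support_eq (G := G) (((List.isChain_map _).1 hc).imp
      fun x y h => (dummyGraph_adj_some G x y).1 h) hLne
    refine ⟨_, _, p, SimpleGraph.Walk.IsPath.mk' (by rw [hp]; exact hn.of_map _), ?_⟩
    rw [hL, hsum, pathWeight, hp]

end

end IntervalRep

/-! ### ### The returned value -/

theorem mainTheorem8 {V : Type*} [Fintype V] [Nonempty V] (G : SimpleGraph V) (w : V → ℕ)
    (I : IntervalRep G) (κ : ℕ) (A B : Finset V) (hAB : I.IsSpecial κ A B)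
    (σ : List V) (hσ : I.IsRightEndpointOrdering σ)
    -- the interval `[a, b]` of the isolated dummy vertex `none`, left of all other intervals
    (a b : ℝ) (hab : a < b) (hb : ∀ v, b < I.left v)
    -- the orders in which the loops run through the points `ξ`, `ζ` and the vertices `y`
    (xs zs : List ℝ) (ys : List (Option V))
    (hxs : Enumerates xs ((I.addDummy a b hab hb).Xi (dummyA A) (dummyB B)))
    (hzs : Enumerates zs ((I.addDummy a b hab hb).Xi (dummyA A) (dummyB B)))
    (hys : Enumerates ys Finset.univ) :
    let J : IntervalRep (dummyGraph G) := I.addDummy a b hab hb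
    let W : Table (Option V) :=
      J.runTable (dummyWeight w) (dummyB B) (none :: σ.map some) xs zs ys
    -- the returned value is the maximum weight of a path in `G`
    (∃ m : ℕ, tableOutput J W = (m : WithBot ℕ) ∧
      IsGreatest {s : ℕ | ∃ (u v : V) (p : G.Walk u v), p.IsPath ∧ s = pathWeight w p} m) ∧
    -- the table entries are the maximum weights of normal paths of the graphs `G_ξ(v)`
    (∀ ξ ∈ J.Xi (dummyA A) (dummyB B), ∀ v : Option V, ξ < J.right v →
      ∀ y ∈ J.between ξ v, (y = v ∨ (dummyGraph G).Adj v y) →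
        ∃ m : ℕ, W ξ v y = (m : WithBot ℕ) ∧
          IsGreatest (J.normalPathWeights (dummyWeight w) ξ v y) m) := by
  classical
  intro J W
  have hcorrect : ∀ v, J.Correct (dummyWeight w) (J.Xi (dummyA A) (dummyB B)) W v := fun v =>
    (hAB.addDummy hab hb).correct_runTable (dummyWeight w) hxs hzs hys (hσ.addDummy hab hb) v
  refine ⟨?_, fun ξ hξ v hv y hy hvy =>
    (hcorrect v ξ hξ hv y hy hvy).exists_isGreatest (J.normalPathWeights_nonempty _ hy)⟩
  -- The dummy vertex puts into `Ξ` a point to the left of all original intervals, so the graphs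
  -- `G_a(v)` impose no restriction on the left.
  have haXi : a ∈ J.Xi (dummyA A) (dummyB B) := by
    rw [IntervalRep.Xi, Finset.mem_union]
    exact Or.inr (Finset.mem_image.2 ⟨none, Finset.none_mem_insertNone, rfl⟩)
  have hentry : ∀ (v : V) (y : Option V), J.right y ≤ J.right (some v) →
      (y = some v ∨ (dummyGraph G).Adj (some v) y) →
      IsMaxOf (W a (some v) y) (J.normalPathWeights (dummyWeight w) a (some v) y) := by
    intro v y hyv hy
    refine hcorrect (some v) a haXi (hab.trans ((hb v).trans (I.left_lt_right v))) y
      (IntervalRep.mem_between.2 ⟨?_, hyv⟩) hy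
    cases y with
    | none => exact le_rfl
    | some y => exact (hab.trans (hb y)).le
  have hout : IsMaxOf (tableOutput J W)
      {s : ℕ | ∃ (u v : V) (p : G.Walk u v), p.IsPath ∧ s = pathWeight w p} := by
    unfold tableOutput
    refine (isMaxOf_finsetSup _ _ (fun v : V =>
      J.normalPathWeights (dummyWeight w) a (some v) (some v) ∪
        {s | ∃ y ∈ Finset.univ.filter fun y => J.right y < J.right (some v) ∧
          (dummyGraph G).Adj (some v) y, s ∈ J.normalPathWeights (dummyWeight w) a (some v) y})
      fun v _ => ?_).congr fun s => ?_
    · refine (hentry v (some v) le_rfl (Or.inl rfl)).max ?_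
      have hsup := isMaxOf_finsetSup (Finset.univ.filter fun y => J.right y < J.right (some v) ∧
        (dummyGraph G).Adj (some v) y) (fun y => W a (some v) y)
        (fun y => J.normalPathWeights (dummyWeight w) a (some v) y) fun y hy =>
          hentry v y (Finset.mem_filter.1 hy).2.1.le (Or.inr (Finset.mem_filter.1 hy).2.2)
      convert hsup
      rfl
    · refine (I.exists_path_weight_iff w hab hb s).trans ?_
      simp only [Finset.mem_univ, true_and, Set.mem_union, Set.mem_ofPred_eq, Finset.mem_filter]
      refine exists_congr fun v => ?_
      constructor
      · rintro ⟨y, rfl | hy, hs⟩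
        · exact Or.inl hs
        · exact Or.inr ⟨y, hy, hs⟩
      · rintro (hs | ⟨y, hy, hs⟩)
        · exact ⟨_, Or.inl rfl, hs⟩
        · exact ⟨y, Or.inr hy, hs⟩
  obtain ⟨v⟩ := ‹Nonempty V›
  exact hout.exists_isGreatest ⟨w v, v, v, .nil, SimpleGraph.Walk.IsPath.nil, by simp [pathWeight]⟩
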